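/- Let $n$ be a positive integer, let $k$ be a number field of degree $m$ over $\mathbb Q$ with discriminant $\Delta_k$, $r$ real embeddings and $s$ pairs of conjugate complex embeddings, and let $S$ be a finite set of places of $k$ containing the archimedean ones. Let $\mathfrak p_1,\dots,\mathfrak p_L$ be the distinct prime ideals of $\mathcal O_k$ corresponding to the non-archimedean places in $S$, let $\mathfrak N(\mathfrak p_l)$ denote their norms, and put $\mathfrak N(S)=(\mathfrak N(\mathfrak p_1),\dots,\mathfrak N(\mathfrak p_L))$. Let $\mathcal O_S$ be the ring of $S$-integers of $k$, and let $$H(a_1,\dots,a_n)=\prod_{v}\max\{1,|a_1|_v,\dots,|a_n|_v\}^{d_v/m}$$ be the absolute multiplicative Weil height on $k^n$, where $v$ runs over all places of $k$, $d_v$ is the local degree of $k$ at $v$, and $|\cdot|_v$ is the absolute value in the class of $v$ that extends a standard absolute value of $\mathbb Q$. Set $$B^{(n)}_{k,S}=\frac{n^{r+s-1}\,2^{sn}\,m^{|S|-1}}{(|S|-1)!\,\bigl(\sqrt{|\Delta_k|}\bigr)^{n}}\prod_{l=1}^{L}\left(\frac{1}{\log\mathfrak N(\mathfrak p_l)}\left(1-\frac{1}{\mathfrak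 N(\mathfrak p_l)^n}\right)\right),$$ where an empty product is $1$. Then for every real $\mathcal H\ge 2$ the number $N(\mathcal H)$ of $\mathbf a\in\mathcal O_S^n$ with $H(\mathbf a)\le\mathcal H$ is finite, and $$\Bigl|N(\mathcal H)-(2^r\pi^s)^n B^{(n)}_{k,S}\,\mathcal H^{mn}(\log\mathcal H)^{|S|-1}\Bigr|\le\begin{cases}C\,\mathcal H^{mn}(\log\mathcal H)^{|S|-2}&\text{if }|S|>1,\\ C\,\mathcal H^{mn-1}&\text{if }|S|=1,\end{cases}$$ where the constant $C$ depends only on $m$, $n$ and $\mathfrak N(S)$. -/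

import Mathlib

open NumberField IsDedekindDomain

noncomputable section

/-- The places of a number field `k`: the archimedean ones, and the non-archimedean ones, which
correspond to the nonzero prime ideals of the ring of integers of `k`. -/
abbrev Place (k : Type*) [Field k] [NumberField k] : Type _ :=
  InfinitePlace k ⊕ HeightOneSpectrum (𝓞 k)

/-- The primes corresponding to the non-archimedean places in `S`. -/
def finPlaces {k : Type*} [Field k] [NumberField k] (S : Finset (Place k)) :
    Finset (HeightOneSpectrum (𝓞 k)) :=
  S.toRight

/-- The family of the norms of the primes corresponding to the non-archimedean places in `S`,
counted with multiplicity. -/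
def placeNorms {k : Type*} [Field k] [NumberField k] (S : Finset (Place k)) : Multiset ℕ :=
  (finPlaces S).val.map fun 𝔭 => Ideal.absNorm 𝔭.asIdeal

/-- The absolute multiplicative Weil height
`H(a₁, …, aₙ) = ∏_v max {1, |a₁|_v, …, |aₙ|_v} ^ (d_v / m)` on `kⁿ`, where `m = [k : ℚ]`.
Mathlib's `Height.mulHeight` is the height of the tuple `(1, a₁, …, aₙ)` relative to `k`,
in which the local factors already carry the exponents `d_v`. -/
def weilHeight {k : Type*} [Field k] [NumberField k] {n : ℕ} (a : Fin n → k) : ℝ :=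
  Height.mulHeight (Fin.cons 1 a : Fin (n + 1) → k) ^ ((Module.finrank ℚ k : ℝ)⁻¹)

/-- The points of `kⁿ` with `S`-integral coordinates and Weil height at most `X`. -/
def sIntegralPoints {k : Type*} [Field k] [NumberField k] (S : Finset (Place k)) (n : ℕ) (X : ℝ) :
    Set (Fin n → k) :=
  {a | (∀ i, a i ∈ (finPlaces S : Set (HeightOneSpectrum (𝓞 k))).integer k) ∧ weilHeight a ≤ X}

/-- The constant `B_{k,S}^{(n)}`. -/
def constB (k : Type*) [Field k] [NumberField k] (S : Finset (Place k)) (n : ℕ) : ℝ :=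
  (n : ℝ) ^ (InfinitePlace.nrRealPlaces k + InfinitePlace.nrComplexPlaces k - 1) *
      2 ^ (InfinitePlace.nrComplexPlaces k * n) *
      (Module.finrank ℚ k : ℝ) ^ (S.card - 1) /
    (((S.card - 1).factorial : ℝ) * Real.sqrt |(discr k : ℝ)| ^ n) *
  ∏ 𝔭 ∈ finPlaces S,
    (1 / Real.log (Ideal.absNorm 𝔭.asIdeal : ℝ) * (1 - 1 / (Ideal.absNorm 𝔭.asIdeal : ℝ) ^ n))

end

section LatticePoints

set_option linter.unusedSectionVars false

open MeasureTheory Module Metric Set ENNReal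

variable {E : Type*} [NormedAddCommGroup E] [NormedSpace ℝ E] [FiniteDimensional ℝ E]
  [MeasurableSpace E] [BorelSpace E] (L : Submodule ℤ E) [DiscreteTopology L] [IsZLattice ℝ L]
  (μ : Measure E) [Measure.IsAddHaarMeasure μ]

theorem exists_fundamentalDomain :
    ∃ F : Set E, IsAddFundamentalDomain L F μ ∧ μ F < ∞ ∧ ZLattice.covolume L μ = μ.real F :=
  ⟨_, ZLattice.isAddFundamentalDomain (Free.chooseBasis ℤ L) μ,
    Bornology.IsBounded.measure_lt_top (ZSpan.fundamentalDomain_isBounded _),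
    ZLattice.covolume_eq_measure_fundamentalDomain L μ
      (ZLattice.isAddFundamentalDomain (Free.chooseBasis ℤ L) μ)⟩

/-- Unfolding: the measure of a set is the integral over a fundamental domain of the number of
lattice translates that hit the set. -/
theorem measure_eq_setLIntegral_encard [Countable L] {F A : Set E}
    (hF : IsAddFundamentalDomain L F μ) (hA : MeasurableSet A) :
    μ A = ∫⁻ x in F, ({a : L | (a : E) + x ∈ A}.encard : ℝ≥0∞) ∂μ := by
  have : MeasurableVAdd L E := (inferInstance : MeasurableVAdd L.toAddSubgroup E)
  have : VAddInvariantMeasure L E μ := (inferInstance : VAddInvariantMeasure L.toAddSubgroup E μ)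
  have h1 : ∀ x : E, ({a : L | (a : E) + x ∈ A}.encard : ℝ≥0∞)
      = ∑' a : L, A.indicator 1 ((a : E) + x) := by
    intro x
    rw [← ENNReal.tsum_set_one, tsum_subtype {a : L | (a : E) + x ∈ A} (fun _ => (1 : ℝ≥0∞))]
    rfl
  simp_rw [h1]
  rw [lintegral_tsum]
  · rw [← lintegral_indicator_one hA, hF.lintegral_eq_tsum'']
    rfl
  · intro a
    exact ((measurable_one.indicator hA).comp (measurable_const_add _)).aemeasurable

theorem measureReal_le_of_encard_le {A : Set E} (hA : MeasurableSet A) (N : ℕ)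
    (h : ∀ x : E, {a : L | (a : E) + x ∈ A}.encard ≤ N) :
    μ.real A ≤ N * ZLattice.covolume L μ := by
  obtain ⟨F, hF, hfin, hcov⟩ := exists_fundamentalDomain L μ
  have h1 : μ A ≤ N * μ F := by
    rw [measure_eq_setLIntegral_encard L μ hF hA, ← setLIntegral_const]
    exact lintegral_mono fun x => by simpa using ENat.toENNReal_mono (h x)
  rw [hcov, Measure.real, Measure.real, ← ENNReal.toReal_natCast, ← ENNReal.toReal_mul]
  exact ENNReal.toReal_mono (ENNReal.mul_ne_top (by simp) hfin.ne) h1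

theorem le_measureReal_of_le_encard {A : Set E} (hA : MeasurableSet A) (hA' : μ A ≠ ∞) (N : ℕ)
    (h : ∀ x : E, N ≤ {a : L | (a : E) + x ∈ A}.encard) :
    N * ZLattice.covolume L μ ≤ μ.real A := by
  obtain ⟨F, hF, hfin, hcov⟩ := exists_fundamentalDomain L μ
  have h1 : N * μ F ≤ μ A := by
    rw [measure_eq_setLIntegral_encard L μ hF hA, ← setLIntegral_const]
    exact lintegral_mono fun x => by simpa using ENat.toENNReal_mono (h x)
  rw [hcov, Measure.real, Measure.real, ← ENNReal.toReal_natCast, ← ENNReal.toReal_mul]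
  exact ENNReal.toReal_mono hA' h1

theorem finite_lattice_inter_closedBall (R : ℝ) : ((L : Set E) ∩ closedBall 0 R).Finite := by
  rw [Set.inter_comm]
  exact Metric.finite_isBounded_inter_isClosed DiscreteTopology.isDiscrete
    isBounded_closedBall (AddSubgroup.isClosed_of_discrete (H := L.toAddSubgroup))

section Covering

variable {L} {ρ : ℝ}

theorem measureReal_closedBall_le_of_covering
    (hcov : ∀ x : E, ∃ a ∈ L, ‖x - a‖ ≤ ρ) :
    μ.real (closedBall 0 (1 - ρ)) ≤
      ((L : Set E) ∩ closedBall 0 1).ncard * ZLattice.covolume L μ := by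
  refine measureReal_le_of_encard_le L μ measurableSet_closedBall _ fun x => ?_
  obtain ⟨b, hb, hxb⟩ := hcov x
  rw [Set.Finite.cast_ncard_eq (finite_lattice_inter_closedBall L 1)]
  refine Set.encard_le_encard_of_injOn (f := fun a : L => (a : E) + b) ?_ ?_
  · intro a ha
    refine ⟨add_mem a.2 hb, ?_⟩
    simp only [mem_closedBall, dist_zero_right, Set.mem_ofPred_eq] at ha ⊢
    calc ‖(a : E) + b‖ = ‖((a : E) + x) - (x - b)‖ := by congr 1; abel
      _ ≤ (1 - ρ) + ρ := (norm_sub_le _ _).trans (add_le_add ha hxb)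
      _ = 1 := by ring
  · intro a _ a' _ h
    exact Subtype.ext (add_right_cancel h)

theorem ncard_mul_covolume_le_of_covering
    (hcov : ∀ x : E, ∃ a ∈ L, ‖x - a‖ ≤ ρ) :
    ((L : Set E) ∩ closedBall 0 1).ncard * ZLattice.covolume L μ ≤
      μ.real (closedBall 0 (1 + ρ)) := by
  refine le_measureReal_of_le_encard L μ measurableSet_closedBall
    measure_closedBall_lt_top.ne _ fun x => ?_
  obtain ⟨b, hb, hxb⟩ := hcov x
  rw [Set.Finite.cast_ncard_eq (finite_lattice_inter_closedBall L 1)]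
  have hsub : ((L : Set E) ∩ closedBall 0 1) ⊆
      (fun a : L => (a : E) + b) '' {a : L | (a : E) + x ∈ closedBall (0 : E) (1 + ρ)} := by
    rintro c ⟨hc, hc1⟩
    refine ⟨⟨c - b, sub_mem hc hb⟩, ?_, by simp⟩
    simp only [mem_closedBall, dist_zero_right, Set.mem_ofPred_eq] at hc1 ⊢
    calc ‖c - b + x‖ = ‖c + (x - b)‖ := by congr 1; abel
      _ ≤ 1 + ρ := (norm_add_le _ _).trans (add_le_add hc1 hxb)
  exact (Set.encard_le_encard hsub).trans (Set.encard_image_le _ _)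

end Covering

/-- If the lattice vectors of length at most `r` span, the covering radius is at most `d * r`. -/
theorem exists_lattice_norm_sub_le_of_span {r : ℝ}
    (h : Submodule.span ℝ ((L : Set E) ∩ closedBall 0 r) = ⊤) (x : E) :
    ∃ a ∈ L, ‖x - a‖ ≤ finrank ℝ E * r := by
  classical
  let b := Basis.ofSpan h.ge
  have hb : ∀ i, b i ∈ (L : Set E) ∩ closedBall 0 r := fun i =>
    Basis.ofSpan_subset h.ge ⟨i, rfl⟩
  have : Fintype _ := FiniteDimensional.fintypeBasisIndex b
  refine ⟨ZSpan.floor b x, ?_, ?_⟩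
  · have : Submodule.span ℤ (Set.range b) ≤ L := by
      rw [Submodule.span_le]
      rintro _ ⟨i, rfl⟩
      exact (hb i).1
    exact this (ZSpan.floor b x).2
  · rw [← ZSpan.fract_apply]
    refine (ZSpan.norm_fract_le b x).trans ?_
    rw [finrank_eq_card_basis b, ← nsmul_eq_mul, ← Finset.card_univ]
    exact Finset.sum_le_card_nsmul _ _ _ fun i _ => by simpa using (hb i).2

section Packing

variable {L} {lam : ℝ}

/-- A direction transverse to a proper subspace `H`, along which lattice points of `H` can be
moved in steps of length `lam / 2` without losing separation. -/
theorem exists_separating_vector (hlam : 0 < lam) (hmin : ∀ a ∈ L, a ≠ 0 → lam ≤ ‖a‖)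
    {H : Submodule ℝ E} (hH : H ≠ ⊤) :
    ∃ u : E, ‖u‖ = lam / 2 ∧ ∀ a ∈ L, a ∈ H → ∀ i j : ℕ,
      ‖a + ((i : ℝ) - j) • u‖ < lam / 4 → a = 0 ∧ i = j := by
  obtain ⟨u, -, hu, hu1⟩ := riesz_lemma_of_lt_one (𝕜 := ℝ) H.closed_of_finiteDimensional
    (by simpa [Submodule.eq_top_iff'] using hH) one_half_lt_one
  have hdist : ∀ (s : ℝ), ∀ y ∈ H, |s| / 2 ≤ ‖y + s • u‖ := by
    intro s y hy
    rcases eq_or_ne s 0 with rfl | hs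
    · simp
    · have := hu1 (-(s⁻¹ • y)) (H.neg_mem (H.smul_mem _ hy))
      have h2 : y + s • u = s • (u - -(s⁻¹ • y)) := by
        rw [sub_neg_eq_add, smul_add, smul_smul, mul_inv_cancel₀ hs, one_smul, add_comm]
      rw [h2, norm_smul, Real.norm_eq_abs, div_eq_mul_one_div]
      exact mul_le_mul_of_nonneg_left this (abs_nonneg s)
  refine ⟨(lam / 2) • u, ?_, ?_⟩
  · rw [norm_smul, hu, mul_one, Real.norm_of_nonneg (by positivity)]
  · intro a haL haH i j h
    have hij : i = j := by
      by_contra hne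
      have h1 : (1 : ℝ) ≤ |(i : ℝ) - j| := by
        have : (1 : ℤ) ≤ |(i : ℤ) - j| := Int.one_le_abs (by omega)
        exact_mod_cast this
      have h2 := hdist (((i : ℝ) - j) * (lam / 2)) a haH
      rw [abs_mul, abs_of_pos (show 0 < lam / 2 by positivity), mul_smul] at h2
      nlinarith
    refine ⟨?_, hij⟩
    by_contra hne
    have := hmin a haL hne
    subst hij
    simp only [sub_self, zero_smul, add_zero] at h
    linarith

theorem measureReal_ball [Nontrivial E] (x : E) {r : ℝ} (hr : 0 ≤ r) :
    μ.real (ball x r) = r ^ finrank ℝ E * μ.real (ball 0 1) := by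
  rw [Measure.real, Measure.addHaar_ball μ x hr, ENNReal.toReal_mul,
    ENNReal.toReal_ofReal (by positivity), Measure.real]

theorem measureReal_biUnion_ball [Nontrivial E] {ι : Type*} (s : Finset ι) (f : ι → E) {r : ℝ}
    (hr : 0 ≤ r) (hs : ∀ i ∈ s, ∀ j ∈ s, ‖f i - f j‖ < 2 * r → i = j) :
    μ.real (⋃ i ∈ s, ball (f i) r) = s.card * (r ^ finrank ℝ E * μ.real (ball 0 1)) := by
  rw [measureReal_biUnion_finset]
  · rw [← nsmul_eq_mul]
    exact Finset.sum_eq_card_nsmul fun i _ => measureReal_ball μ _ hr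
  · intro i hi j hj hij
    refine Set.disjoint_left.mpr fun x hx hx' => hij (hs i hi j hj ?_)
    rw [mem_ball, dist_eq_norm] at hx hx'
    calc ‖f i - f j‖ = ‖(x - f j) - (x - f i)‖ := by congr 1; abel
      _ ≤ ‖x - f j‖ + ‖x - f i‖ := norm_sub_le _ _
      _ < 2 * r := by linarith
  · exact fun _ _ => measurableSet_ball

theorem measureReal_unitBall_pos : 0 < μ.real (ball (0 : E) 1) :=
  ENNReal.toReal_pos (measure_ball_pos μ 0 one_pos).ne' measure_ball_lt_top.ne

theorem half_div_le_floor {r : ℝ} (hlam : 0 < lam) (hr : lam ≤ r) :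
    r / (2 * lam) ≤ ⌊r / lam⌋₊ := by
  have h1 : 1 ≤ r / lam := (one_le_div hlam).mpr hr
  have h2 : (1 : ℝ) ≤ ⌊r / lam⌋₊ := by exact_mod_cast Nat.le_floor (by simpa using h1)
  have h3 := Nat.lt_floor_add_one (r / lam)
  have h4 : r / (2 * lam) = r / lam / 2 := by field_simp
  rw [h4]; linarith

theorem pow_mul_measureReal_le_covolume [Nontrivial E] (hlam : 0 < lam)
    (hmin : ∀ a ∈ L, a ≠ 0 → lam ≤ ‖a‖) :
    lam ^ finrank ℝ E * μ.real (ball 0 1) ≤ 2 ^ finrank ℝ E * ZLattice.covolume L μ := by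
  have h := measureReal_le_of_encard_le L μ (A := ball 0 (lam / 2)) measurableSet_ball 1 ?_
  · rw [measureReal_ball μ 0 (by positivity), Nat.cast_one, one_mul, div_pow, div_mul_eq_mul_div,
      div_le_iff₀ (by positivity)] at h
    linarith
  · intro x
    rw [Nat.cast_one, Set.encard_le_one_iff]
    intro a b ha hb
    by_contra hab
    have := hmin (a - b) (sub_mem a.2 b.2) (by simpa [sub_eq_zero] using hab)
    simp only [mem_ball, dist_zero_right, Set.mem_ofPred_eq] at ha hb
    have h2 : ‖(a : E) - b‖ = ‖((a : E) + x) - (b + x)‖ := by congr 1; abel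
    have h3 := norm_sub_le ((a : E) + x) (b + x)
    linarith

/-- If the lattice vectors of length at most `r` do not span, the covolume is large. -/
theorem mul_pow_mul_measureReal_le_covolume [Nontrivial E] {r : ℝ} (hlam : 0 < lam)
    (hmin : ∀ a ∈ L, a ≠ 0 → lam ≤ ‖a‖) (hr : lam ≤ r)
    (h : Submodule.span ℝ ((L : Set E) ∩ closedBall 0 r) ≠ ⊤) :
    r * lam ^ (finrank ℝ E - 1) * μ.real (ball 0 1) ≤
      2 * 8 ^ finrank ℝ E * ZLattice.covolume L μ := by
  obtain ⟨u, hu, hsep⟩ := exists_separating_vector hlam hmin h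
  set I := ⌊r / lam⌋₊ with hI
  have hIr : (I : ℝ) * (lam / 2) ≤ r / 2 := by
    have := Nat.floor_le (a := r / lam) (div_nonneg (hlam.le.trans hr) hlam.le)
    rw [le_div_iff₀ hlam] at this
    linarith
  have hle := measureReal_le_of_encard_le L μ
    (A := ⋃ i ∈ Finset.range I, ball ((i : ℝ) • u) (lam / 8))
    (Finset.measurableSet_biUnion _ fun _ _ => measurableSet_ball) 1 ?_
  · rw [measureReal_biUnion_ball μ _ _ (by positivity), Finset.card_range, div_pow,
      Nat.cast_one, one_mul] at hle
    · have h1 := half_div_le_floor hlam hr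
      have hV := measureReal_unitBall_pos (E := E) μ
      have h2 : r / (2 * lam) * (lam ^ finrank ℝ E / 8 ^ finrank ℝ E * μ.real (ball (0 : E) 1)) ≤
          ZLattice.covolume L μ :=
        le_trans (mul_le_mul_of_nonneg_right h1 (by positivity)) hle
      have h3 : lam ^ finrank ℝ E = lam ^ (finrank ℝ E - 1) * lam := by
        rw [← pow_succ, Nat.sub_add_cancel finrank_pos]
      rw [h3] at h2
      have h4 : r / (2 * lam) * (lam ^ (finrank ℝ E - 1) * lam / 8 ^ finrank ℝ E *
          μ.real (ball (0 : E) 1)) = r * lam ^ (finrank ℝ E - 1) * μ.real (ball (0 : E) 1) /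
          (2 * 8 ^ finrank ℝ E) := by
        field_simp
      rw [h4, div_le_iff₀ (by positivity)] at h2
      linarith
    · intro i _ j _ hij
      refine (hsep 0 (zero_mem _) (zero_mem _) i j ?_).2
      rw [zero_add, sub_smul]; linarith
  · intro x
    rw [Nat.cast_one, Set.encard_le_one_iff]
    intro a b ha hb
    simp only [Set.mem_ofPred_eq, Set.mem_iUnion, Finset.mem_range, mem_ball, dist_eq_norm,
      exists_prop] at ha hb
    obtain ⟨i, hi, ha⟩ := ha
    obtain ⟨j, hj, hb⟩ := hb
    have h1 : ‖((a : E) - b) + ((j : ℝ) - i) • u‖ < lam / 4 := by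
      calc ‖((a : E) - b) + ((j : ℝ) - i) • u‖
          = ‖((a : E) + x - (i : ℝ) • u) - ((b : E) + x - (j : ℝ) • u)‖ := by
            congr 1; rw [sub_smul]; abel
        _ ≤ _ := norm_sub_le _ _
        _ < lam / 4 := by linarith
    have h2 : ‖((j : ℝ) - i) • u‖ ≤ r / 2 := by
      rw [norm_smul, hu, Real.norm_eq_abs]
      refine le_trans (mul_le_mul_of_nonneg_right ?_ (by positivity)) hIr
      rw [abs_le]
      have hi' : (i : ℝ) ≤ I := by exact_mod_cast hi.le
      have hj' : (j : ℝ) ≤ I := by exact_mod_cast hj.le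
      have hi0 : (0 : ℝ) ≤ i := i.cast_nonneg
      have hj0 : (0 : ℝ) ≤ j := j.cast_nonneg
      constructor <;> linarith
    have h3 : ‖(a : E) - b‖ ≤ r := by
      have := norm_sub_le (((a : E) - b) + ((j : ℝ) - i) • u) (((j : ℝ) - i) • u)
      rw [add_sub_cancel_right] at this
      linarith
    have h4 := (hsep (a - b) (sub_mem a.2 b.2)
      (Submodule.subset_span ⟨sub_mem a.2 b.2, by simpa using h3⟩) j i h1).1
    exact Subtype.ext (sub_eq_zero.mp h4)

/-- If the lattice vectors in the unit ball do not span, there are few of them. -/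
theorem ncard_mul_pow_le_of_not_span [Nontrivial E] (hlam : 0 < lam) (hlam1 : lam ≤ 1)
    (hmin : ∀ a ∈ L, a ≠ 0 → lam ≤ ‖a‖)
    (h : Submodule.span ℝ ((L : Set E) ∩ closedBall 0 1) ≠ ⊤) :
    ((L : Set E) ∩ closedBall 0 1).ncard * lam ^ (finrank ℝ E - 1) ≤ 2 * 16 ^ finrank ℝ E := by
  let F : Measure E := Measure.addHaar
  obtain ⟨u, hu, hsep⟩ := exists_separating_vector hlam hmin h
  set I := ⌊1 / lam⌋₊ with hI
  have hIr : (I : ℝ) * (lam / 2) ≤ 1 / 2 := by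
    have := Nat.floor_le (a := 1 / lam) (by positivity)
    rw [le_div_iff₀ hlam] at this
    linarith
  have hfin := finite_lattice_inter_closedBall L 1
  have hsub : (⋃ p ∈ hfin.toFinset ×ˢ Finset.range I, ball (p.1 + (p.2 : ℝ) • u) (lam / 8)) ⊆
      ball (0 : E) 2 := by
    intro x hx
    simp only [Set.mem_iUnion, Finset.mem_product, Finset.mem_range, Set.Finite.mem_toFinset,
      mem_ball, dist_eq_norm, exists_prop, Prod.exists] at hx
    obtain ⟨a, i, ⟨ha, hi⟩, hx⟩ := hx
    rw [mem_ball, dist_zero_right]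
    have ha1 : ‖a‖ ≤ 1 := by simpa using ha.2
    have h2 : ‖(i : ℝ) • u‖ ≤ 1 / 2 := by
      rw [norm_smul, hu, Real.norm_of_nonneg i.cast_nonneg]
      refine le_trans (mul_le_mul_of_nonneg_right ?_ (by positivity)) hIr
      exact_mod_cast hi.le
    calc ‖x‖ = ‖(x - (a + (i : ℝ) • u)) + (a + (i : ℝ) • u)‖ := by congr 1; abel
      _ ≤ ‖x - (a + (i : ℝ) • u)‖ + (‖a‖ + ‖(i : ℝ) • u‖) :=
        (norm_add_le _ _).trans (add_le_add le_rfl (norm_add_le _ _))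
      _ < 2 := by linarith
  have hle := measureReal_mono (μ := F) hsub measure_ball_lt_top.ne
  rw [measureReal_ball F 0 zero_le_two, measureReal_biUnion_ball F _ _ (by positivity), Finset.card_product,
    Finset.card_range, ← Set.ncard_eq_toFinset_card _ hfin, ← mul_assoc] at hle
  · have hV := measureReal_unitBall_pos (E := E) F
    have h5 := le_of_mul_le_mul_right hle hV
    have h1 := half_div_le_floor hlam hlam1
    rw [← hI] at h1
    push_cast at h5
    set N : ℝ := (((L : Set E) ∩ closedBall 0 1).ncard : ℝ) with hN
    have hN0 : 0 ≤ N := Nat.cast_nonneg _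
    have h6 : N * (1 / (2 * lam)) * (lam / 8) ^ finrank ℝ E ≤ 2 ^ finrank ℝ E :=
      le_trans (mul_le_mul_of_nonneg_right (mul_le_mul_of_nonneg_left h1 hN0) (by positivity)) h5
    have h3 : lam ^ finrank ℝ E = lam ^ (finrank ℝ E - 1) * lam := by
      rw [← pow_succ, Nat.sub_add_cancel finrank_pos]
    rw [div_pow, h3] at h6
    have h4 : N * (1 / (2 * lam)) * (lam ^ (finrank ℝ E - 1) * lam / 8 ^ finrank ℝ E) =
        N * lam ^ (finrank ℝ E - 1) / (2 * 8 ^ finrank ℝ E) := by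
      field_simp
    rw [h4, div_le_iff₀ (by positivity)] at h6
    calc N * lam ^ (finrank ℝ E - 1) ≤ 2 ^ finrank ℝ E * (2 * 8 ^ finrank ℝ E) := h6
      _ = 2 * (2 * 8) ^ finrank ℝ E := by rw [mul_pow]; ring
      _ = 2 * 16 ^ finrank ℝ E := by norm_num
  · rintro ⟨a, i⟩ ha ⟨b, j⟩ hb hab
    simp only [Finset.mem_product, Set.Finite.mem_toFinset, Finset.mem_range] at ha hb hab
    have h1 : ‖(a - b) + ((i : ℝ) - j) • u‖ < lam / 4 := by
      have : (a - b) + ((i : ℝ) - j) • u = a + (i : ℝ) • u - (b + (j : ℝ) • u) := by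
        rw [sub_smul]; abel
      rw [this]; linarith
    obtain ⟨h2, h3⟩ := hsep (a - b) (sub_mem ha.1.1 hb.1.1)
      (sub_mem (Submodule.subset_span ha.1) (Submodule.subset_span hb.1)) i j h1
    rw [sub_eq_zero.mp h2, h3]

end Packing

theorem one_add_pow_le_one_add_two_pow_mul {x : ℝ} (hx : 0 ≤ x) (hx1 : x ≤ 1) (k : ℕ) :
    (1 + x) ^ k ≤ 1 + (2 ^ k - 1) * x := by
  induction k with
  | zero => simp
  | succ k ih =>
    have h1 : (1 : ℝ) ≤ 2 ^ k := one_le_pow₀ one_le_two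
    calc (1 + x) ^ (k + 1) = (1 + x) ^ k * (1 + x) := pow_succ _ _
      _ ≤ (1 + (2 ^ k - 1) * x) * (1 + x) := by gcongr
      _ ≤ 1 + (2 ^ (k + 1) - 1) * x := by
        rw [pow_succ]
        nlinarith [mul_nonneg (mul_nonneg (sub_nonneg.mpr h1) hx) (sub_nonneg.mpr hx1)]

/-- The constant in the lattice point count `abs_ncard_lattice_inter_closedBall_sub_le`. -/
noncomputable def latticeConst (d : ℕ) : ℝ :=
  (2 ^ d + (1 + d) ^ d + 1) * (d * (4 * 8 ^ d)) + 2 * 16 ^ d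

/-- The number of lattice points in the unit ball of a normed space, with an error term that
depends only on the dimension and the length of the shortest nonzero lattice vector. -/
theorem abs_ncard_lattice_inter_closedBall_sub_le [Nontrivial E] {lam : ℝ} (hlam : 0 < lam)
    (hlam1 : lam ≤ 1) (hmin : ∀ a ∈ L, a ≠ 0 → lam ≤ ‖a‖) :
    |(((L : Set E) ∩ closedBall 0 1).ncard : ℝ) - μ.real (ball 0 1) / ZLattice.covolume L μ| ≤
      latticeConst (finrank ℝ E) / lam ^ (finrank ℝ E - 1) := by
  set d := finrank ℝ E with hd
  set V := μ.real (ball (0 : E) 1) with hV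
  set D := ZLattice.covolume L μ with hD
  set N : ℝ := (((L : Set E) ∩ closedBall 0 1).ncard : ℝ) with hN
  have hN0 : 0 ≤ N := Nat.cast_nonneg _
  have hV0 : 0 < V := measureReal_unitBall_pos μ
  have hD0 : 0 < D := ZLattice.covolume_pos L μ
  have hd0 : 0 < d := finrank_pos
  have hd1 : (1 : ℝ) ≤ d := by exact_mod_cast hd0
  have hcb : ∀ r : ℝ, 0 ≤ r → μ.real (closedBall (0 : E) r) = r ^ d * V := fun r hr =>
    Measure.addHaar_real_closedBall μ 0 hr
  have hP : 0 < lam ^ (d - 1) := by positivity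
  set r := 4 * 8 ^ d * D / (lam ^ (d - 1) * V) with hr
  have hr0 : 0 < r := by positivity
  have hrV : r * lam ^ (d - 1) * V = 4 * 8 ^ d * D := by rw [hr]; field_simp
  have hlr : lam ≤ r := by
    rw [hr, le_div_iff₀ (by positivity)]
    have h1 := pow_mul_measureReal_le_covolume μ hlam hmin
    rw [← hd, ← hV, ← hD] at h1
    have h3 : lam ^ d = lam * lam ^ (d - 1) := by
      rw [← pow_succ', Nat.sub_add_cancel hd0]
    rw [h3] at h1
    have h4 : (2 : ℝ) ^ d ≤ 8 ^ d := by gcongr; norm_num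
    have h5 : (2 : ℝ) ^ d * D ≤ 8 ^ d * D := by gcongr
    have h6 : 0 < (8 : ℝ) ^ d * D := by positivity
    linarith
  have hspan : Submodule.span ℝ ((L : Set E) ∩ closedBall 0 r) = ⊤ := by
    by_contra hne
    have h1 := mul_pow_mul_measureReal_le_covolume μ hlam hmin hlr hne
    rw [← hd, ← hV, ← hD, hrV] at h1
    have h6 : 0 < (8 : ℝ) ^ d * D := by positivity
    linarith
  have hcov := exists_lattice_norm_sub_le_of_span L hspan
  rw [← hd] at hcov
  set ρ := d * r with hρ
  have hρ0 : 0 < ρ := by positivity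
  have hρV : ρ * V / D = d * (4 * 8 ^ d) / lam ^ (d - 1) := by
    rw [hρ, hr]; field_simp
  have hc0 : 0 ≤ (d : ℝ) * (4 * 8 ^ d) := by positivity
  rcases le_or_gt ρ 1 with hρ1 | hρ1
  · have hlow := measureReal_closedBall_le_of_covering μ hcov
    have hupp := ncard_mul_covolume_le_of_covering μ hcov
    rw [hcb _ (by linarith), ← hN, ← hD] at hlow hupp
    have hb1 : 1 - 2 ^ d * ρ ≤ (1 - ρ) ^ d := by
      have h1 := one_add_mul_le_pow (a := -ρ) (by linarith) d
      have h2 : (d : ℝ) ≤ 2 ^ d := by exact_mod_cast Nat.lt_two_pow_self.le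
      have h3 : d * ρ ≤ 2 ^ d * ρ := by gcongr
      rw [← sub_eq_add_neg] at h1
      linarith
    have hb2 := one_add_pow_le_one_add_two_pow_mul hρ0.le hρ1 d
    have h1 : |N - V / D| ≤ 2 ^ d * (ρ * V / D) := by
      have h2 : N - V / D = (N * D - V) / D := by field_simp
      rw [h2, abs_div, abs_of_pos hD0, mul_div_assoc', div_le_div_iff_of_pos_right hD0, abs_le]
      constructor
      · nlinarith
      · nlinarith [mul_pos hρ0 hV0]
    refine h1.trans ?_
    rw [hρV, mul_div_assoc', latticeConst]
    gcongr
    have h7 : 0 ≤ ((1 + d : ℝ) ^ d + 1) * (d * (4 * 8 ^ d)) := by positivity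
    have h8 : 0 ≤ (2 : ℝ) * 16 ^ d := by positivity
    linarith
  · have hVD : V / D ≤ d * (4 * 8 ^ d) / lam ^ (d - 1) := by
      rw [← hρV, mul_div_assoc]
      exact le_mul_of_one_le_left (by positivity) hρ1.le
    have hNb : N ≤ ((1 + d) ^ d * (d * (4 * 8 ^ d)) + 2 * 16 ^ d) / lam ^ (d - 1) := by
      by_cases h1 : Submodule.span ℝ ((L : Set E) ∩ closedBall 0 1) = ⊤
      · have hcov1 := exists_lattice_norm_sub_le_of_span L h1
        have hupp := ncard_mul_covolume_le_of_covering μ hcov1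
        rw [hcb _ (by positivity), ← hN, ← hD, ← hd, mul_one, ← le_div_iff₀ hD0,
          mul_div_assoc] at hupp
        refine hupp.trans ((mul_le_mul_of_nonneg_left hVD (by positivity)).trans ?_)
        rw [mul_div_assoc']
        gcongr
        have h8 : 0 ≤ (2 : ℝ) * 16 ^ d := by positivity
        linarith
      · have h2 := ncard_mul_pow_le_of_not_span hlam hlam1 hmin h1
        rw [← hN, ← hd] at h2
        rw [le_div_iff₀ hP]
        refine h2.trans ?_
        have h7 : 0 ≤ (1 + d : ℝ) ^ d * (d * (4 * 8 ^ d)) := by positivity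
        linarith
    have h3 : |N - V / D| ≤ N + V / D := by
      have : 0 ≤ V / D := by positivity
      rw [abs_le]; constructor <;> linarith
    refine h3.trans ((add_le_add hNb hVD).trans ?_)
    rw [← add_div, latticeConst]
    refine div_le_div_of_nonneg_right ?_ hP.le
    have h7 : 0 ≤ (2 : ℝ) ^ d * (d * (4 * 8 ^ d)) := by positivity
    linarith

end LatticePoints

section IdealPoints

open MeasureTheory Module Metric NumberField.InfinitePlace NumberField.mixedEmbedding
open scoped nonZeroDivisors NNReal Classical

set_option linter.unusedSectionVars false

variable {k : Type*} [Field k] [NumberField k]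

theorem absNorm_le_abs_norm_of_mem (I : (FractionalIdeal (𝓞 k)⁰ k)ˣ) {a : k}
    (ha : a ∈ (I : FractionalIdeal (𝓞 k)⁰ k)) (ha0 : a ≠ 0) :
    FractionalIdeal.absNorm (I : FractionalIdeal (𝓞 k)⁰ k) ≤ |Algebra.norm ℚ a| := by
  have hle : FractionalIdeal.spanSingleton (𝓞 k)⁰ a * ((I⁻¹ : (FractionalIdeal (𝓞 k)⁰ k)ˣ) :
      FractionalIdeal (𝓞 k)⁰ k) ≤ 1 := by
    calc _ ≤ (I : FractionalIdeal (𝓞 k)⁰ k) * ((I⁻¹ : (FractionalIdeal (𝓞 k)⁰ k)ˣ) :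
          FractionalIdeal (𝓞 k)⁰ k) :=
          mul_le_mul_left (FractionalIdeal.spanSingleton_le_iff_mem.mpr ha) _
      _ = 1 := by simp
  obtain ⟨J, hJ⟩ := FractionalIdeal.le_one_iff_exists_coeIdeal.mp hle
  have hJ' : FractionalIdeal.spanSingleton (𝓞 k)⁰ a = I * (J : FractionalIdeal (𝓞 k)⁰ k) := by
    rw [hJ, mul_comm, mul_assoc]; simp
  have h1 := congr_arg FractionalIdeal.absNorm hJ'
  rw [map_mul, FractionalIdeal.absNorm_span_singleton, FractionalIdeal.coeIdeal_absNorm] at h1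
  rw [h1]
  refine le_mul_of_one_le_right (FractionalIdeal.absNorm_nonneg _) ?_
  have hJ0 : J ≠ ⊥ := by
    rintro rfl
    rw [FractionalIdeal.coeIdeal_bot, mul_zero, FractionalIdeal.spanSingleton_eq_zero_iff] at hJ'
    exact ha0 hJ'
  have : Ideal.absNorm J ≠ 0 := Ideal.absNorm_eq_zero_iff.not.mpr hJ0
  exact_mod_cast Nat.one_le_iff_ne_zero.mpr this

theorem norm_mixedSpace_le_iff {x : mixedSpace k} {r : ℝ} :
    ‖x‖ ≤ r ↔ ∀ w, normAtPlace w x ≤ r := by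
  rw [norm_eq_sup'_normAtPlace, Finset.sup'_le_iff]; simp

theorem norm_mixedSpace_lt_iff {x : mixedSpace k} {r : ℝ} :
    ‖x‖ < r ↔ ∀ w, normAtPlace w x < r := by
  rw [norm_eq_sup'_normAtPlace, Finset.sup'_lt_iff]; simp

theorem mem_convexBodyLT_iff {x : mixedSpace k} {f : InfinitePlace k → ℝ≥0} :
    x ∈ convexBodyLT k f ↔ ∀ w, normAtPlace w x < f w := by
  simp only [Set.mem_prod, Set.mem_pi, Set.mem_univ, forall_true_left, mem_ball_zero_iff]
  constructor
  · rintro ⟨h1, h2⟩ w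
    rcases isReal_or_isComplex w with hw | hw
    · simpa [normAtPlace_apply_of_isReal hw] using h1 ⟨w, hw⟩
    · simpa [normAtPlace_apply_of_isComplex hw] using h2 ⟨w, hw⟩
  · intro h
    refine ⟨fun w => ?_, fun w => ?_⟩
    · simpa [normAtPlace_apply_of_isReal w.2] using h w
    · simpa [normAtPlace_apply_of_isComplex w.2] using h w

/-- The element of the mixed space with coordinate `t w` at each infinite place `w`. -/
noncomputable def mixedDiag (t : InfinitePlace k → ℝ) : mixedSpace k :=
  (fun w => t w, fun w => t w)

theorem normAtPlace_mixedDiag (t : InfinitePlace k → ℝ) (w : InfinitePlace k) :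
    normAtPlace w (mixedDiag t) = |t w| := by
  rcases isReal_or_isComplex w with hw | hw
  · simp [normAtPlace_apply_of_isReal hw, mixedDiag]
  · simp [normAtPlace_apply_of_isComplex hw, mixedDiag]

theorem mixedDiag_mul (s t : InfinitePlace k → ℝ) :
    mixedDiag s * mixedDiag t = mixedDiag (fun w => s w * t w) := by
  ext <;> simp [mixedDiag]

theorem mixedDiag_one : mixedDiag (fun _ : InfinitePlace k => 1) = 1 := by
  ext <;> simp [mixedDiag]

/-- Rescaling of the mixed space by the factor `t w` at each infinite place `w`. -/
noncomputable def mixedScale (t : InfinitePlace k → ℝ) (ht : ∀ w, 0 < t w) :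
    mixedSpace k ≃L[ℝ] mixedSpace k :=
  LinearEquiv.toContinuousLinearEquiv
    { toFun := fun x => mixedDiag t * x
      invFun := fun x => mixedDiag (fun w => (t w)⁻¹) * x
      map_add' := fun x y => mul_add _ _ _
      map_smul' := fun c x => by simp
      left_inv := fun x => by
        change _ * (_ * x) = x
        rw [← mul_assoc, mixedDiag_mul]
        simp [fun w => (ht w).ne', mixedDiag_one]
      right_inv := fun x => by
        change _ * (_ * x) = x
        rw [← mul_assoc, mixedDiag_mul]
        simp [fun w => (ht w).ne', mixedDiag_one] }

theorem normAtPlace_mixedScale (t : InfinitePlace k → ℝ) (ht : ∀ w, 0 < t w) (x : mixedSpace k)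
    (w : InfinitePlace k) : normAtPlace w (mixedScale t ht x) = t w * normAtPlace w x := by
  change normAtPlace w (mixedDiag t * x) = _
  rw [map_mul, normAtPlace_mixedDiag, abs_of_pos (ht w)]

/-- The elements of a fractional ideal bounded by `t w` at each infinite place `w`. -/
def boundedElements (I : (FractionalIdeal (𝓞 k)⁰ k)ˣ) (t : InfinitePlace k → ℝ) : Set k :=
  {a | a ∈ (I : FractionalIdeal (𝓞 k)⁰ k) ∧ ∀ w : InfinitePlace k, w a ≤ t w}

theorem image_boundedElements (I : (FractionalIdeal (𝓞 k)⁰ k)ˣ) (t : InfinitePlace k → ℝ)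
    (ht : ∀ w, 0 < t w) :
    (fun a => (mixedScale t ht).symm (mixedEmbedding k a)) '' boundedElements I t =
      (ZLattice.comap ℝ (idealLattice k I) (mixedScale t ht).toLinearMap : Set (mixedSpace k)) ∩
        closedBall 0 1 := by
  ext x
  have key : x ∈ closedBall (0 : mixedSpace k) 1 ↔
      ∀ w, normAtPlace w (mixedScale t ht x) ≤ t w := by
    rw [mem_closedBall, dist_zero_right, norm_mixedSpace_le_iff]
    refine forall_congr' fun w => ?_
    rw [normAtPlace_mixedScale]
    exact (mul_le_iff_le_one_right (ht w)).symm
  have key2 : x ∈ (ZLattice.comap ℝ (idealLattice k I) (mixedScale t ht).toLinearMap :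
      Set (mixedSpace k)) ↔ ∃ y, y ∈ (I : Set k) ∧ mixedEmbedding k y = mixedScale t ht x := by
    rw [← mem_idealLattice]; rfl
  rw [Set.mem_inter_iff, key, key2]
  constructor
  · rintro ⟨a, ⟨ha, hb⟩, rfl⟩
    refine ⟨⟨a, ha, by simp⟩, fun w => ?_⟩
    simpa [normAtPlace_apply] using hb w
  · rintro ⟨⟨a, ha, hx⟩, hb⟩
    refine ⟨a, ⟨ha, fun w => ?_⟩, by simp [hx]⟩
    simpa [← hx, normAtPlace_apply] using hb w

theorem finite_boundedElements (I : (FractionalIdeal (𝓞 k)⁰ k)ˣ) (t : InfinitePlace k → ℝ)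
    (ht : ∀ w, 0 < t w) : (boundedElements I t).Finite := by
  refine Set.Finite.of_finite_image (f := fun a => (mixedScale t ht).symm (mixedEmbedding k a)) ?_
    (((mixedScale t ht).symm.injective.comp (mixedEmbedding_injective k)).injOn)
  rw [image_boundedElements]
  exact finite_lattice_inter_closedBall _ 1

/-- The leading constant in the count of elements of a fractional ideal. -/
noncomputable def idealConst (k : Type*) [Field k] [NumberField k] : ℝ :=
  2 ^ nrRealPlaces k * Real.pi ^ nrComplexPlaces k * 2 ^ nrComplexPlaces k / √|(discr k : ℝ)|

theorem abs_ncard_boundedElements_sub_le (I : (FractionalIdeal (𝓞 k)⁰ k)ˣ)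
    (t : InfinitePlace k → ℝ) (ht : ∀ w, 0 < t w) {y : ℝ} (hy : 1 ≤ y)
    (hyI : y * FractionalIdeal.absNorm (I : FractionalIdeal (𝓞 k)⁰ k) = ∏ w, t w ^ mult w) :
    |((boundedElements I t).ncard : ℝ) - idealConst k * y| ≤
      latticeConst (finrank ℚ k) * y ^ (1 - 1 / (finrank ℚ k : ℝ)) := by
  set m := finrank ℚ k with hm
  have hm0 : 0 < m := finrank_pos
  have hfr : finrank ℝ (mixedSpace k) = m := mixedEmbedding.finrank k
  set e := mixedScale t ht with he
  have hy0 : 0 < y := one_pos.trans_le hy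
  let μ : Measure (mixedSpace k) := Measure.map e.symm volume
  have hμ : μ.IsAddHaarMeasure := e.symm.isAddHaarMeasure_map volume
  have hpres : MeasurePreserving e μ volume := by
    refine ⟨e.continuous.measurable, ?_⟩
    rw [Measure.map_map e.continuous.measurable e.symm.continuous.measurable]
    simp
  have hcovol := ZLattice.covolume_comap (idealLattice k I) volume μ hpres
  rw [mixedEmbedding.covolume_idealLattice] at hcovol
  have hball : μ.real (ball 0 1) =
      2 ^ nrRealPlaces k * Real.pi ^ nrComplexPlaces k * ∏ w, t w ^ mult w := by
    have h1 : e.symm ⁻¹' ball 0 1 = convexBodyLT k (fun w => (t w).toNNReal) := by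
      ext x
      rw [mem_convexBodyLT_iff, Set.mem_preimage, mem_ball, dist_zero_right,
        norm_mixedSpace_lt_iff]
      refine forall_congr' fun w => ?_
      have h2 : normAtPlace w x = t w * normAtPlace w (e.symm x) := by
        rw [← normAtPlace_mixedScale t ht, ← he]; simp
      rw [h2, Real.coe_toNNReal _ (ht w).le]
      exact (mul_lt_iff_lt_one_right (ht w)).symm
    rw [Measure.real, Measure.map_apply e.symm.continuous.measurable measurableSet_ball, h1,
      convexBodyLT_volume]
    simp [ENNReal.toReal_prod, Real.coe_toNNReal _ (ht _).le]
  have hnI : (0 : ℝ) < FractionalIdeal.absNorm (I : FractionalIdeal (𝓞 k)⁰ k) := by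
    have h1 : FractionalIdeal.absNorm (I : FractionalIdeal (𝓞 k)⁰ k) ≠ 0 := by
      rw [ne_eq, FractionalIdeal.absNorm_eq_zero_iff]; exact Units.ne_zero I
    exact_mod_cast lt_of_le_of_ne (FractionalIdeal.absNorm_nonneg _) h1.symm
  set lam : ℝ := y ^ (-(1 / (m : ℝ))) with hlam
  have hlam0 : 0 < lam := by positivity
  have hlam1 : lam ≤ 1 := Real.rpow_le_one_of_one_le_of_nonpos hy (by
    rw [neg_nonpos]; positivity)
  have hlamm : lam ^ m = y⁻¹ := by
    rw [hlam, ← Real.rpow_natCast, ← Real.rpow_mul hy0.le, neg_mul, one_div,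
      inv_mul_cancel₀ (by positivity), Real.rpow_neg_one]
  have hmain := abs_ncard_lattice_inter_closedBall_sub_le
    (ZLattice.comap ℝ (idealLattice k I) e.toLinearMap) μ hlam0 hlam1 ?_
  · rw [hcovol, hball, hfr, ← image_boundedElements, Set.ncard_image_of_injective
      (f := fun a => (mixedScale t ht).symm (mixedEmbedding k a)) _ (e.symm.injective.comp (mixedEmbedding_injective k)), ← hyI] at hmain
    convert hmain using 1
    · congr 2
      rw [idealConst, inv_pow]
      field_simp
    · rw [div_eq_mul_inv]
      congr 1
      rw [hlam, ← Real.rpow_natCast, ← Real.rpow_mul hy0.le, ← Real.rpow_neg hy0.le]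
      congr 1
      rw [Nat.cast_sub (show 1 ≤ m from hm0), Nat.cast_one]
      field_simp
  · intro x hx hx0
    obtain ⟨a, ha, hax⟩ := (mem_idealLattice k I).mp hx
    have hax' : mixedEmbedding k a = e x := hax
    have ha0 : a ≠ 0 := by
      rintro rfl
      rw [map_zero] at hax'
      exact hx0 (by simpa using hax'.symm)
    have h1 := absNorm_le_abs_norm_of_mem I ha ha0
    have h2 : ((FractionalIdeal.absNorm (I : FractionalIdeal (𝓞 k)⁰ k) : ℚ) : ℝ) ≤
        ∏ w, normAtPlace w (e x) ^ mult w := by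
      rw [← mixedEmbedding.norm_apply, ← hax', mixedEmbedding.norm_eq_norm]
      exact_mod_cast h1
    have h3 : ∏ w, normAtPlace w (e x) ^ mult w ≤ (∏ w, t w ^ mult w) * ‖x‖ ^ m := by
      rw [hm, ← sum_mult_eq, ← Finset.prod_pow_eq_pow_sum, ← Finset.prod_mul_distrib]
      refine Finset.prod_le_prod (fun w _ => pow_nonneg (normAtPlace_nonneg _ _) _) fun w _ => ?_
      rw [he, normAtPlace_mixedScale, mul_pow]
      refine mul_le_mul_of_nonneg_left (pow_le_pow_left₀ (normAtPlace_nonneg _ _) ?_ _)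
        (pow_nonneg (ht w).le _)
      exact norm_mixedSpace_le_iff.mp le_rfl w
    rw [← hyI] at h3
    have h4 : y⁻¹ ≤ ‖x‖ ^ m := by
      rw [inv_le_iff_one_le_mul₀' hy0]
      have h5 := h2.trans h3
      rw [mul_right_comm] at h5
      exact (le_mul_iff_one_le_left hnI).mp h5
    rw [← hlamm] at h4
    exact (pow_le_pow_iff_left₀ hlam0.le (norm_nonneg _) hm0.ne').mp h4

end IdealPoints

section Denominators

open NumberField.InfinitePlace WithZero NumberField.HeightOneSpectrum
open scoped nonZeroDivisors Classical

variable {k : Type*} [Field k] [NumberField k]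

theorem finitePlace_mk_eq_zpow (𝔭 : HeightOneSpectrum (𝓞 k)) {a : k} (ha : a ≠ 0) :
    ∃ z : ℤ, 𝔭.valuation k a = exp z ∧
      FinitePlace.mk 𝔭 a = (Ideal.absNorm 𝔭.asIdeal : ℝ) ^ z := by
  have h0 : 𝔭.valuation k a ≠ 0 := (Valuation.ne_zero_iff _).mpr ha
  refine ⟨log (𝔭.valuation k a), (exp_log h0).symm, ?_⟩
  rw [FinitePlace.mk_apply, FinitePlace.norm_embedding', WithZeroMulInt.toNNReal_neg_apply _ h0]
  simp only [NNReal.coe_zpow, NNReal.coe_natCast]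
  congr 1
  conv_rhs => rw [← coe_unzero h0]
  rfl

theorem finitePlace_mk_le_zpow_iff (𝔭 : HeightOneSpectrum (𝓞 k)) (a : k) (z : ℤ) :
    FinitePlace.mk 𝔭 a ≤ (Ideal.absNorm 𝔭.asIdeal : ℝ) ^ z ↔ 𝔭.valuation k a ≤ exp z := by
  have hN : (1 : ℝ) < Ideal.absNorm 𝔭.asIdeal := by exact_mod_cast one_lt_absNorm 𝔭
  rcases eq_or_ne a 0 with rfl | ha
  · simp only [map_zero, zero_le, iff_true]
    positivity
  · obtain ⟨y, hy, hy'⟩ := finitePlace_mk_eq_zpow 𝔭 ha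
    rw [hy, hy', exp_le_exp, zpow_le_zpow_iff_right₀ hN]

theorem finitePlace_mk_le_one_iff (𝔭 : HeightOneSpectrum (𝓞 k)) (a : k) :
    FinitePlace.mk 𝔭 a ≤ 1 ↔ 𝔭.valuation k a ≤ 1 := by
  simpa using finitePlace_mk_le_zpow_iff 𝔭 a 0

theorem not_prod_pow_le_pow_succ (F : Finset (HeightOneSpectrum (𝓞 k)))
    (e : HeightOneSpectrum (𝓞 k) → ℕ) (he : ∀ 𝔭 ∉ F, e 𝔭 = 0) (𝔭 : HeightOneSpectrum (𝓞 k)) :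
    ¬ ∏ 𝔮 ∈ F, 𝔮.asIdeal ^ e 𝔮 ≤ 𝔭.asIdeal ^ (e 𝔭 + 1) := by
  intro h
  have h1 : ∏ 𝔮 ∈ F, 𝔮.asIdeal ^ e 𝔮 =
      𝔭.asIdeal ^ e 𝔭 * ∏ 𝔮 ∈ F.erase 𝔭, 𝔮.asIdeal ^ e 𝔮 := by
    by_cases h2 : 𝔭 ∈ F
    · exact (Finset.mul_prod_erase F _ h2).symm
    · rw [he 𝔭 h2, pow_zero, one_mul, Finset.erase_eq_of_notMem h2]
  rw [h1, ← Ideal.dvd_iff_le, pow_succ] at h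
  have h3 := (mul_dvd_mul_iff_left (pow_ne_zero _ 𝔭.ne_bot)).mp h
  obtain ⟨𝔮, h𝔮, h4⟩ := (𝔭.prime.dvd_finsetProd_iff _).mp h3
  have h5 := 𝔭.prime.dvd_of_dvd_pow h4
  rw [Ideal.dvd_iff_le] at h5
  exact Finset.ne_of_mem_erase h𝔮
    (HeightOneSpectrum.ext (𝔮.isMaximal.eq_of_le 𝔭.isPrime.ne_top h5))

theorem mem_inv_prod_pow_iff (F : Finset (HeightOneSpectrum (𝓞 k)))
    (e : HeightOneSpectrum (𝓞 k) → ℕ) (he : ∀ 𝔭 ∉ F, e 𝔭 = 0) (a : k) :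
    a ∈ ((∏ 𝔮 ∈ F, 𝔮.asIdeal ^ e 𝔮 : Ideal (𝓞 k)) : FractionalIdeal (𝓞 k)⁰ k)⁻¹ ↔
      ∀ 𝔭 : HeightOneSpectrum (𝓞 k),
        FinitePlace.mk 𝔭 a ≤ (Ideal.absNorm 𝔭.asIdeal : ℝ) ^ e 𝔭 := by
  set D : Ideal (𝓞 k) := ∏ 𝔮 ∈ F, 𝔮.asIdeal ^ e 𝔮 with hD
  have hD0 : D ≠ 0 := Finset.prod_ne_zero_iff.mpr fun 𝔮 _ => pow_ne_zero _ 𝔮.ne_bot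
  have hN : ∀ 𝔭 : HeightOneSpectrum (𝓞 k), (0 : ℝ) < Ideal.absNorm 𝔭.asIdeal := fun 𝔭 => by
    exact_mod_cast zero_lt_one.trans (one_lt_absNorm 𝔭)
  have hDle : ∀ 𝔭 : HeightOneSpectrum (𝓞 k), D ≤ 𝔭.asIdeal ^ e 𝔭 := by
    intro 𝔭
    by_cases h2 : 𝔭 ∈ F
    · exact Ideal.le_of_dvd (Finset.dvd_prod_of_mem (fun 𝔮 => 𝔮.asIdeal ^ e 𝔮) h2)
    · rw [he 𝔭 h2, pow_zero, Ideal.one_eq_top]; exact le_top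
  rw [FractionalIdeal.mem_inv_iff (FractionalIdeal.coeIdeal_ne_zero.mpr hD0)]
  constructor
  · intro h 𝔭
    obtain ⟨x, hxD, hx⟩ := Set.not_subset.mp (not_prod_pow_le_pow_succ F e he 𝔭)
    obtain ⟨y, -, hy⟩ := (FractionalIdeal.mem_coeIdeal _).mp
      (FractionalIdeal.coeIdeal_top (R := 𝓞 k) (S := (𝓞 k)⁰) (P := k) ▸
        h (algebraMap _ _ x) ((FractionalIdeal.mem_coeIdeal _).mpr ⟨x, hxD, rfl⟩))
    have h1 : FinitePlace.mk 𝔭 (a * algebraMap (𝓞 k) k x) ≤ 1 := by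
      rw [← hy, finitePlace_mk_le_one_iff]
      exact 𝔭.valuation_le_one y
    have hx0 : algebraMap (𝓞 k) k x ≠ 0 := by
      intro h0
      rw [FaithfulSMul.algebraMap_eq_zero_iff] at h0
      exact hx (h0 ▸ zero_mem _)
    obtain ⟨z, hz, hz'⟩ := finitePlace_mk_eq_zpow 𝔭 hx0
    have h2 : -(e 𝔭 : ℤ) ≤ z := by
      by_contra hlt
      refine hx ((𝔭.intValuation_le_pow_iff_mem x (e 𝔭 + 1)).mp ?_)
      rw [← 𝔭.valuation_of_algebraMap (K := k), hz, exp_le_exp]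
      push_cast
      omega
    rw [map_mul, hz', ← le_div_iff₀ (zpow_pos (hN 𝔭) _), one_div, ← zpow_neg] at h1
    refine h1.trans ?_
    rw [← zpow_natCast]
    exact zpow_le_zpow_right₀ (by exact_mod_cast (one_lt_absNorm 𝔭).le) (by omega)
  · intro h b hb
    obtain ⟨x, hxD, rfl⟩ := (FractionalIdeal.mem_coeIdeal _).mp hb
    rw [FractionalIdeal.mem_one_iff]
    refine HeightOneSpectrum.mem_integers_of_valuation_le_one k _ fun 𝔭 => ?_
    rw [← finitePlace_mk_le_one_iff, map_mul]
    have h1 : FinitePlace.mk 𝔭 (algebraMap (𝓞 k) k x) ≤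
        (Ideal.absNorm 𝔭.asIdeal : ℝ) ^ (-(e 𝔭 : ℤ)) := by
      rw [finitePlace_mk_le_zpow_iff, 𝔭.valuation_of_algebraMap]
      exact (𝔭.intValuation_le_pow_iff_mem x (e 𝔭)).mpr (hDle 𝔭 hxD)
    calc _ ≤ (Ideal.absNorm 𝔭.asIdeal : ℝ) ^ e 𝔭 *
          (Ideal.absNorm 𝔭.asIdeal : ℝ) ^ (-(e 𝔭 : ℤ)) := by
          refine mul_le_mul (h 𝔭) h1 (apply_nonneg _ _) (by positivity)
      _ = 1 := by
          rw [zpow_neg, zpow_natCast, mul_inv_cancel₀ (pow_ne_zero _ (hN 𝔭).ne')]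

/-- The elements of `k` that are integral outside `F`, with denominator bounded by `e` at the primes
of `F` and absolute value bounded by `t` at the infinite places. -/
def boxElements (F : Finset (HeightOneSpectrum (𝓞 k))) (e : F → ℕ) (t : InfinitePlace k → ℝ) :
    Set k :=
  {a | (∀ 𝔭 ∉ F, FinitePlace.mk 𝔭 a ≤ 1) ∧
    (∀ 𝔭 : F, FinitePlace.mk 𝔭.1 a ≤ (Ideal.absNorm 𝔭.1.asIdeal : ℝ) ^ e 𝔭) ∧
    ∀ w : InfinitePlace k, w a ≤ t w}

theorem exists_boundedElements_eq_boxElements (F : Finset (HeightOneSpectrum (𝓞 k))) (e : F → ℕ) :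
    ∃ I : (FractionalIdeal (𝓞 k)⁰ k)ˣ,
      (∀ t : InfinitePlace k → ℝ, boundedElements I t = boxElements F e t) ∧
      (FractionalIdeal.absNorm (I : FractionalIdeal (𝓞 k)⁰ k) : ℝ) *
        ∏ 𝔭 : F, (Ideal.absNorm 𝔭.1.asIdeal : ℝ) ^ e 𝔭 = 1 := by
  let e' : HeightOneSpectrum (𝓞 k) → ℕ := fun 𝔭 => if h : 𝔭 ∈ F then e ⟨𝔭, h⟩ else 0
  have he' : ∀ 𝔭 ∉ F, e' 𝔭 = 0 := fun 𝔭 h => dif_neg h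
  have he'F : ∀ 𝔭 : F, e' 𝔭 = e 𝔭 := fun 𝔭 => dif_pos 𝔭.2
  set D : Ideal (𝓞 k) := ∏ 𝔮 ∈ F, 𝔮.asIdeal ^ e' 𝔮 with hD
  have hD0 : (D : FractionalIdeal (𝓞 k)⁰ k) ≠ 0 := FractionalIdeal.coeIdeal_ne_zero.mpr
    (Finset.prod_ne_zero_iff.mpr fun 𝔮 _ => pow_ne_zero _ 𝔮.ne_bot)
  refine ⟨(Units.mk0 (D : FractionalIdeal (𝓞 k)⁰ k) hD0)⁻¹, fun t => ?_, ?_⟩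
  · ext a
    rw [boundedElements, boxElements, Set.mem_ofPred_eq, Set.mem_ofPred_eq, Units.val_inv_eq_inv_val,
      Units.val_mk0, hD, mem_inv_prod_pow_iff F e' he', ← and_assoc]
    refine and_congr_left fun _ => ⟨fun h => ⟨fun 𝔭 h𝔭 => ?_, fun 𝔭 => ?_⟩, fun h 𝔭 => ?_⟩
    · simpa [he' 𝔭 h𝔭] using h 𝔭
    · simpa [he'F 𝔭] using h 𝔭
    · by_cases h𝔭 : 𝔭 ∈ F
      · have := h.2 ⟨𝔭, h𝔭⟩
        rwa [← he'F ⟨𝔭, h𝔭⟩] at this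
      · have := h.1 𝔭 h𝔭
        rwa [he' 𝔭 h𝔭, pow_zero]
  · have h1 : ∏ 𝔭 : F, (Ideal.absNorm 𝔭.1.asIdeal : ℝ) ^ e 𝔭 = (Ideal.absNorm D : ℝ) := by
      rw [hD, map_prod, Nat.cast_prod, ← Finset.prod_coe_sort F
        fun 𝔮 => ((Ideal.absNorm (𝔮.asIdeal ^ e' 𝔮) : ℕ) : ℝ)]
      refine Finset.prod_congr rfl fun 𝔭 _ => ?_
      rw [he'F 𝔭, map_pow, Nat.cast_pow]
    have h2 : FractionalIdeal.absNorm ((Units.mk0 (D : FractionalIdeal (𝓞 k)⁰ k) hD0)⁻¹ :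
        (FractionalIdeal (𝓞 k)⁰ k)ˣ).val * (Ideal.absNorm D : ℚ) = 1 := by
      rw [← FractionalIdeal.coeIdeal_absNorm (K := k), ← map_mul, Units.val_inv_eq_inv_val,
        Units.val_mk0, inv_mul_cancel₀ hD0, map_one]
    rw [h1]
    exact_mod_cast h2

theorem finite_boxElements (F : Finset (HeightOneSpectrum (𝓞 k))) (e : F → ℕ)
    (t : InfinitePlace k → ℝ) (ht : ∀ w, 0 < t w) : (boxElements F e t).Finite := by
  obtain ⟨I, hI, -⟩ := exists_boundedElements_eq_boxElements F e
  rw [← hI]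
  exact finite_boundedElements I t ht

theorem abs_ncard_boxElements_sub_le (F : Finset (HeightOneSpectrum (𝓞 k))) (e : F → ℕ)
    (t : InfinitePlace k → ℝ) (ht : ∀ w, 0 < t w) {y : ℝ} (hy : 1 ≤ y)
    (hyt : y = (∏ w, t w ^ mult w) * ∏ 𝔭 : F, (Ideal.absNorm 𝔭.1.asIdeal : ℝ) ^ e 𝔭) :
    |((boxElements F e t).ncard : ℝ) - idealConst k * y| ≤
      latticeConst (Module.finrank ℚ k) * y ^ (1 - 1 / (Module.finrank ℚ k : ℝ)) := by
  obtain ⟨I, hI, hnorm⟩ := exists_boundedElements_eq_boxElements F e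
  rw [← hI]
  refine abs_ncard_boundedElements_sub_le I t ht hy ?_
  rw [hyt, mul_assoc, mul_comm _ (FractionalIdeal.absNorm _ : ℝ), hnorm, mul_one]

end Denominators

section SimplexCount

set_option linter.unusedSectionVars false

/-- The increments of `j ↦ exp (n * ℓ * j)`, starting with the value `1` at `j = 0`. -/
noncomputable def expIncrement (n : ℕ) (ℓ : ℝ) : ℕ → ℝ
  | 0 => 1
  | j + 1 => Real.exp (n * (ℓ * (j + 1 : ℕ))) - Real.exp (n * (ℓ * j))

/-- The sum of the products of increments `expIncrement n ℓᵢ jᵢ` over the points `j` with natural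
coordinates of the simplex `∑ ℓᵢ jᵢ ≤ τ`. -/
noncomputable def simplexSum (n : ℕ) : List ℝ → ℝ → ℝ
  | [], _ => 1
  | ℓ :: l, τ => ∑ j ∈ Finset.range (⌊τ / ℓ⌋₊ + 1), expIncrement n ℓ j * simplexSum n l (τ - ℓ * j)

variable {Ω ι : Type*} [Fintype ι] [DecidableEq ι] (κ : Ω → ι → ℕ) (ℓ : ι → ℝ)

/-- The points whose indices are bounded by `i` outside `l` and lie in a simplex along `l`. -/
def mixedRegion (l : List ι) (i : ι → ℕ) (τ : ℝ) : Set Ω :=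
  {a | (∀ v ∉ l, κ a v ≤ i v) ∧ (l.map fun v => ℓ v * κ a v).sum ≤ τ}

theorem finite_mixedRegion {κ : Ω → ι → ℕ} {ℓ : ι → ℝ} (hℓ : ∀ v, 0 < ℓ v)
    (hfin : ∀ i : ι → ℕ, {a | ∀ v, κ a v ≤ i v}.Finite) (l : List ι) (i : ι → ℕ) (τ : ℝ) :
    (mixedRegion κ ℓ l i τ).Finite := by
  refine (hfin fun v => max (i v) ⌊τ / ℓ v⌋₊).subset fun a ha v => ?_
  by_cases hv : v ∈ l
  · refine le_max_of_le_right (Nat.le_floor ?_)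
    rw [le_div_iff₀ (hℓ v), mul_comm]
    refine le_trans ?_ ha.2
    exact List.single_le_sum (by
      intro x hx
      obtain ⟨w, -, rfl⟩ := List.mem_map.mp hx
      exact mul_nonneg (hℓ w).le (Nat.cast_nonneg _)) _ (List.mem_map.mpr ⟨v, hv, rfl⟩)
  · exact le_max_of_le_left (ha.1 v hv)

theorem sum_filter_notMem_update {w : ι} {l : List ι} (hw : w ∉ l) (i : ι → ℕ) (j : ℕ) :
    ∑ v with v ∉ l, ℓ v * (Function.update i w j v : ℕ) =
      ℓ w * j + ∑ v with v ∉ w :: l, ℓ v * (i v : ℕ) := by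
  rw [← Finset.add_sum_erase _ _ (show w ∈ Finset.univ.filter (· ∉ l) by simpa using hw)]
  congr 1
  · simp
  · refine Finset.sum_congr ?_ fun v hv => ?_
    · ext v; simp
    · have : v ≠ w := by
        simp only [List.mem_cons, not_or, Finset.mem_filter] at hv
        exact hv.2.1
      rw [Function.update_of_ne this]

theorem mem_mixedRegion_update {κ : Ω → ι → ℕ} {ℓ : ι → ℝ} {w : ι} {l : List ι} (hw : w ∉ l)
    (i : ι → ℕ) (j : ℕ) (τ : ℝ) (a : Ω) :
    a ∈ mixedRegion κ ℓ l (Function.update i w j) τ ↔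
      κ a w ≤ j ∧ (∀ v ∉ w :: l, κ a v ≤ i v) ∧ (l.map fun v => ℓ v * κ a v).sum ≤ τ := by
  rw [mixedRegion, Set.mem_ofPred_eq, ← and_assoc]
  refine and_congr_left fun _ => ⟨fun h => ⟨by simpa using h w hw, fun v hv => ?_⟩, ?_⟩
  · simp only [List.mem_cons, not_or] at hv
    simpa [Function.update_of_ne hv.1] using h v hv.2
  · rintro ⟨h1, h2⟩ v hv
    rcases eq_or_ne v w with rfl | hvw
    · simpa using h1
    · rw [Function.update_of_ne hvw]
      exact h2 v (by simp [hvw, hv])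

/-- Slicing a mixed region along the first direction of the simplex. -/
theorem ncard_mixedRegion_cons {κ : Ω → ι → ℕ} {ℓ : ι → ℝ} (hℓ : ∀ v, 0 < ℓ v)
    (hfin : ∀ i : ι → ℕ, {a | ∀ v, κ a v ≤ i v}.Finite) {w : ι} {l : List ι} (hw : w ∉ l)
    (i : ι → ℕ) (τ : ℝ) :
    ((mixedRegion κ ℓ (w :: l) i τ).ncard : ℝ) = ∑ j ∈ Finset.range (⌊τ / ℓ w⌋₊ + 1),
      (((mixedRegion κ ℓ l (Function.update i w j) (τ - ℓ w * j)).ncard : ℝ) -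
        if j = 0 then 0
        else ((mixedRegion κ ℓ l (Function.update i w (j - 1)) (τ - ℓ w * j)).ncard : ℝ)) := by
  have hF := finite_mixedRegion hℓ hfin
  rw [Set.ncard_eq_toFinset_card _ (hF (w :: l) i τ),
    Finset.card_eq_sum_card_fiberwise (f := fun a => κ a w)
      (t := Finset.range (⌊τ / ℓ w⌋₊ + 1)), Nat.cast_sum]
  · refine Finset.sum_congr rfl fun j _ => ?_
    have hpiece : ((Finset.filter (fun a => κ a w = j) (hF (w :: l) i τ).toFinset : Finset Ω) :
        Set Ω) = {a | κ a w = j ∧ (∀ v ∉ w :: l, κ a v ≤ i v) ∧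
          (l.map fun v => ℓ v * κ a v).sum ≤ τ - ℓ w * j} := by
      ext a
      simp only [Finset.coe_filter, Set.Finite.mem_toFinset, mixedRegion, Set.mem_ofPred_eq,
        List.map_cons, List.sum_cons]
      constructor
      · rintro ⟨⟨h1, h2⟩, rfl⟩
        exact ⟨rfl, h1, by linarith⟩
      · rintro ⟨rfl, h1, h2⟩
        exact ⟨⟨h1, by linarith⟩, rfl⟩
    rw [← Set.ncard_coe_finset, hpiece]
    rcases j with _ | j
    · rw [if_pos rfl, sub_zero]
      congr 2
      ext a
      rw [mem_mixedRegion_update hw]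
      simp
    · rw [if_neg (Nat.succ_ne_zero j), Nat.add_sub_cancel, eq_sub_iff_add_eq]
      norm_cast
      rw [← Set.ncard_union_eq ?_ ((hF l (Function.update i w (j + 1))
        (τ - ℓ w * (j + 1 : ℕ))).subset fun a ha => by
          rw [mem_mixedRegion_update hw]; exact ⟨ha.1.le, ha.2⟩) (hF _ _ _)]
      · congr 1
        ext a
        rw [Set.mem_union, mem_mixedRegion_update hw, mem_mixedRegion_update hw,
          Set.mem_ofPred_eq, ← or_and_right]
        refine and_congr_left fun _ => ?_
        omega
      · refine Set.disjoint_left.mpr fun a ha hb => ?_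
        have h1 := ((mem_mixedRegion_update hw i j _ a).mp hb).1
        have h2 : κ a w = j + 1 := ha.1
        omega
  · intro a ha
    rw [Set.Finite.coe_toFinset] at ha
    simp only [Finset.coe_range, Set.mem_Iio, Nat.lt_succ_iff]
    refine Nat.le_floor ?_
    rw [le_div_iff₀ (hℓ w), mul_comm]
    have h1 := ha.2
    rw [List.map_cons, List.sum_cons] at h1
    have h2 : 0 ≤ (l.map fun v => ℓ v * (κ a v : ℝ)).sum := List.sum_nonneg (by
      intro x hx
      obtain ⟨w, -, rfl⟩ := List.mem_map.mp hx
      exact mul_nonneg (hℓ w).le (Nat.cast_nonneg _))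
    linarith

theorem abs_ncard_mixedRegion_sub_le {κ : Ω → ι → ℕ} {ℓ : ι → ℝ} (hℓ : ∀ v, 0 < ℓ v)
    (hfin : ∀ i : ι → ℕ, {a | ∀ v, κ a v ≤ i v}.Finite) (n : ℕ) {B E c : ℝ} (hE : 0 ≤ E)
    (hbox : ∀ i : ι → ℕ, ∑ v, ℓ v * i v ≤ B →
      |({a | ∀ v, κ a v ≤ i v}.ncard : ℝ) - c * Real.exp (n * ∑ v, ℓ v * i v)| ≤ E)
    (l : List ι) (hl : l.Nodup) (i : ι → ℕ) {τ : ℝ} (hτ : 0 ≤ τ)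
    (hB : τ + ∑ v with v ∉ l, ℓ v * i v ≤ B) :
    |((mixedRegion κ ℓ l i τ).ncard : ℝ) -
        c * Real.exp (n * ∑ v with v ∉ l, ℓ v * i v) * simplexSum n (l.map ℓ) τ| ≤
      E * (l.map fun v => 2 * (1 + B / ℓ v)).prod := by
  induction l generalizing i τ with
  | nil =>
    have h1 : mixedRegion κ ℓ [] i τ = {a | ∀ v, κ a v ≤ i v} := by
      ext a; simp [mixedRegion, hτ]
    simp only [List.not_mem_nil, not_false_eq_true, Finset.filter_true] at hB ⊢
    simpa [h1, simplexSum] using hbox i (by linarith)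
  | cons w l ih =>
    obtain ⟨hw, hl⟩ := List.nodup_cons.mp hl
    set s := ∑ v with v ∉ w :: l, ℓ v * (i v : ℝ) with hs
    have hs0 : 0 ≤ s := Finset.sum_nonneg fun v _ => mul_nonneg (hℓ v).le (Nat.cast_nonneg _)
    set P := (l.map fun v => 2 * (1 + B / ℓ v)).prod with hP
    have hB0 : 0 ≤ B := by linarith
    have hP0 : 0 ≤ P := List.prod_nonneg (by
      intro x hx
      obtain ⟨v, -, rfl⟩ := List.mem_map.mp hx
      have := (hℓ v).le
      positivity)
    rw [ncard_mixedRegion_cons hℓ hfin hw, List.map_cons, simplexSum, Finset.mul_sum,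
      ← Finset.sum_sub_distrib, List.map_cons, List.prod_cons]
    have hterm : ∀ j ∈ Finset.range (⌊τ / ℓ w⌋₊ + 1),
        |(((mixedRegion κ ℓ l (Function.update i w j) (τ - ℓ w * j)).ncard : ℝ) -
          if j = 0 then 0
          else ((mixedRegion κ ℓ l (Function.update i w (j - 1)) (τ - ℓ w * j)).ncard : ℝ)) -
          c * Real.exp (n * s) *
            (expIncrement n (ℓ w) j * simplexSum n (l.map ℓ) (τ - ℓ w * j))| ≤ 2 * (E * P) := by
      intro j hj
      have hjτ : ℓ w * j ≤ τ := by
        have h1 : (j : ℝ) ≤ ⌊τ / ℓ w⌋₊ := by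
          exact_mod_cast Nat.lt_succ_iff.mp (Finset.mem_range.mp hj)
        have h2 := h1.trans (Nat.floor_le (div_nonneg hτ (hℓ w).le))
        rw [le_div_iff₀ (hℓ w)] at h2
        linarith
      have hEP : 0 ≤ E * P := mul_nonneg hE hP0
      have h1 := ih hl (Function.update i w j) (τ := τ - ℓ w * j) (by linarith)
        (by rw [sum_filter_notMem_update ℓ hw]; linarith)
      rw [sum_filter_notMem_update ℓ hw, ← hs] at h1
      rcases j with _ | j
      · simp only [if_true, sub_zero, expIncrement, one_mul]
        simp only [Nat.cast_zero, mul_zero, zero_add, sub_zero] at h1 ⊢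
        linarith
      · have h2 := ih hl (Function.update i w j) (τ := τ - ℓ w * (j + 1 : ℕ)) (by linarith)
          (by
            rw [sum_filter_notMem_update ℓ hw]
            have : ℓ w * j ≤ ℓ w * (j + 1 : ℕ) := by
              have := (hℓ w).le
              gcongr
              simp
            linarith)
        rw [sum_filter_notMem_update ℓ hw, ← hs] at h2
        simp only [Nat.succ_ne_zero, if_false, Nat.add_sub_cancel, expIncrement]
        rw [mul_add, Real.exp_add, ← Real.norm_eq_abs] at h1 h2
        have h3 := (norm_sub_le _ _).trans (add_le_add h1 h2)
        rw [← two_mul] at h3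
        refine (le_of_eq ?_).trans h3
        rw [Real.norm_eq_abs]
        congr 1
        push_cast
        ring
    refine (Finset.abs_sum_le_sum_abs _ _).trans ((Finset.sum_le_card_nsmul _ _ _ hterm).trans ?_)
    rw [Finset.card_range, nsmul_eq_mul, Nat.cast_add, Nat.cast_one]
    have h4 : (⌊τ / ℓ w⌋₊ : ℝ) ≤ B / ℓ w :=
      (Nat.floor_le (div_nonneg hτ (hℓ w).le)).trans
        (div_le_div_of_nonneg_right (by linarith) (hℓ w).le)
    have h5 : 0 ≤ 2 * (E * P) := by positivity
    calc _ ≤ (B / ℓ w + 1) * (2 * (E * P)) := by gcongr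
      _ = _ := by ring

end SimplexCount

section SimplexAsymptotics

theorem pow_succ_sub_pow_succ_le {y h : ℝ} (hy : 0 ≤ y) (hh : 0 ≤ h) (p : ℕ) :
    (y + h) ^ (p + 1) - y ^ (p + 1) ≤ (p + 1) * h * (y + h) ^ p := by
  induction p with
  | zero => simp
  | succ p ih =>
    have h1 : y ^ (p + 1) ≤ (y + h) ^ (p + 1) := by gcongr; linarith
    have h2 := mul_le_mul_of_nonneg_left ih (add_nonneg hy hh)
    have h3 := mul_le_mul_of_nonneg_left h1 hh
    push_cast
    linear_combination h2 + h3

theorem le_pow_succ_sub_pow_succ {y h : ℝ} (hy : 0 ≤ y) (hh : 0 ≤ h) (p : ℕ) :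
    (p + 1) * h * y ^ p ≤ (y + h) ^ (p + 1) - y ^ (p + 1) := by
  induction p with
  | zero => simp
  | succ p ih =>
    have h1 : y ^ (p + 1) ≤ (y + h) ^ (p + 1) := by gcongr; linarith
    have h2 := mul_le_mul_of_nonneg_left ih hy
    have h3 := mul_nonneg hh (sub_nonneg.mpr h1)
    push_cast
    linear_combination h2 + h3

theorem sub_mul_nonneg_of_le_floor {τ ℓ : ℝ} (hτ : 0 ≤ τ) (hℓ : 0 < ℓ) {j : ℕ}
    (hj : j ≤ ⌊τ / ℓ⌋₊) : 0 ≤ τ - ℓ * j := by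
  have h1 : (j : ℝ) ≤ τ / ℓ :=
    le_trans (by exact_mod_cast hj) (Nat.floor_le (div_nonneg hτ hℓ.le))
  rw [le_div_iff₀ hℓ] at h1
  linarith

/-- Comparison of the sum of `x ^ p` over an arithmetic progression with its integral. -/
theorem abs_sum_pow_sub_le {τ ℓ : ℝ} (hτ : 0 ≤ τ) (hℓ : 0 < ℓ) (p : ℕ) :
    |ℓ * ∑ j ∈ Finset.range (⌊τ / ℓ⌋₊ + 1), (τ - ℓ * j) ^ p - τ ^ (p + 1) / (p + 1)| ≤
      ℓ * τ ^ p := by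
  have hlow : ∀ N ≤ ⌊τ / ℓ⌋₊, τ ^ (p + 1) - (τ - ℓ * N) ^ (p + 1) ≤
      (p + 1) * ℓ * ∑ j ∈ Finset.range N, (τ - ℓ * j) ^ p := by
    intro N
    induction N with
    | zero => simp
    | succ N ih =>
      intro hN
      have h1 := pow_succ_sub_pow_succ_le (sub_mul_nonneg_of_le_floor hτ hℓ hN) hℓ.le p
      have h2 : τ - ℓ * ((N + 1 : ℕ) : ℝ) + ℓ = τ - ℓ * N := by push_cast; ring
      rw [h2] at h1
      rw [Finset.sum_range_succ, mul_add]
      linarith [ih (by omega)]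
  have hupp : ∀ N ≤ ⌊τ / ℓ⌋₊, (p + 1) * ℓ * ∑ j ∈ Finset.range (N + 1), (τ - ℓ * j) ^ p ≤
      (p + 1) * ℓ * τ ^ p + (τ ^ (p + 1) - (τ - ℓ * N) ^ (p + 1)) := by
    intro N
    induction N with
    | zero => simp
    | succ N ih =>
      intro hN
      have h1 := le_pow_succ_sub_pow_succ (sub_mul_nonneg_of_le_floor hτ hℓ hN) hℓ.le p
      have h2 : τ - ℓ * ((N + 1 : ℕ) : ℝ) + ℓ = τ - ℓ * N := by push_cast; ring
      rw [h2] at h1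
      rw [Finset.sum_range_succ, mul_add]
      linarith [ih (by omega)]
  have h1 := hlow _ le_rfl
  have h2 := hupp _ le_rfl
  set M := ⌊τ / ℓ⌋₊ with hM
  have hM0 := sub_mul_nonneg_of_le_floor hτ hℓ hM.le
  have hM1 : τ - ℓ * M ≤ ℓ := by
    have := Nat.lt_floor_add_one (τ / ℓ)
    rw [div_lt_iff₀ hℓ] at this
    linarith
  have hlast : (τ - ℓ * M) ^ (p + 1) ≤ (p + 1) * ℓ * (τ - ℓ * M) ^ p := by
    rw [pow_succ', mul_comm ((p : ℝ) + 1), mul_assoc]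
    have h3 : (τ - ℓ * M) ^ p ≤ (p + 1) * (τ - ℓ * M) ^ p :=
      le_mul_of_one_le_left (by positivity) (by simp)
    exact mul_le_mul hM1 h3 (by positivity) hℓ.le
  have hlow' : τ ^ (p + 1) ≤ (p + 1) * ℓ * ∑ j ∈ Finset.range (M + 1), (τ - ℓ * j) ^ p := by
    rw [Finset.sum_range_succ, mul_add]
    linarith
  have hpow : 0 ≤ (τ - ℓ * M) ^ (p + 1) := by positivity
  set S := ∑ j ∈ Finset.range (M + 1), (τ - ℓ * (j : ℝ)) ^ p
  have hp : (0 : ℝ) < p + 1 := by positivity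
  have h4 : ℓ * S - τ ^ (p + 1) / (p + 1) = ((p + 1) * ℓ * S - τ ^ (p + 1)) / (p + 1) := by
    field_simp
  rw [h4, abs_div, abs_of_pos hp, div_le_iff₀ hp, abs_of_nonneg (by linarith)]
  linarith

theorem expIncrement_mul_exp (n : ℕ) (ℓ : ℝ) (j : ℕ) :
    expIncrement n ℓ j * Real.exp (-(n * (ℓ * j))) =
      (1 - Real.exp (-(n * ℓ))) + if j = 0 then Real.exp (-(n * ℓ)) else 0 := by
  rcases j with _ | j
  · simp [expIncrement]
  · simp only [expIncrement, Nat.succ_ne_zero, if_false, add_zero]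
    rw [sub_mul, ← Real.exp_add, ← Real.exp_add]
    congr 1
    · simp
    · congr 1; push_cast; ring

theorem exp_mul_simplexSum_cons (n : ℕ) {ℓ : ℝ} (l : List ℝ) (τ : ℝ) :
    Real.exp (-(n * τ)) * simplexSum n (ℓ :: l) τ =
      (1 - Real.exp (-(n * ℓ))) * ∑ j ∈ Finset.range (⌊τ / ℓ⌋₊ + 1),
          Real.exp (-(n * (τ - ℓ * j))) * simplexSum n l (τ - ℓ * j) +
        Real.exp (-(n * ℓ)) * (Real.exp (-(n * τ)) * simplexSum n l τ) := by
  have h : ∀ j : ℕ, Real.exp (-(n * τ)) * (expIncrement n ℓ j * simplexSum n l (τ - ℓ * j)) =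
      (1 - Real.exp (-(n * ℓ))) *
        (Real.exp (-(n * (τ - ℓ * j))) * simplexSum n l (τ - ℓ * j)) +
      if j = 0 then Real.exp (-(n * ℓ)) * (Real.exp (-(n * τ)) * simplexSum n l τ) else 0 := by
    intro j
    have h1 : Real.exp (-(n * τ)) =
        Real.exp (-(n * (ℓ * j))) * Real.exp (-(n * (τ - ℓ * j))) := by
      rw [← Real.exp_add]; congr 1; ring
    have h2 := expIncrement_mul_exp n ℓ j
    calc _ = (expIncrement n ℓ j * Real.exp (-(n * (ℓ * j)))) *
          (Real.exp (-(n * (τ - ℓ * j))) * simplexSum n l (τ - ℓ * j)) := by rw [h1]; ring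
      _ = _ := by
        rw [h2, add_mul]
        congr 1
        split_ifs with hj
        · simp [hj]
        · simp
  rw [simplexSum, Finset.mul_sum, Finset.sum_congr rfl fun j _ => h j, Finset.sum_add_distrib,
    Finset.sum_ite_eq' , if_pos (by simp), Finset.mul_sum]

theorem sum_expIncrement (n : ℕ) (ℓ : ℝ) (M : ℕ) :
    ∑ j ∈ Finset.range (M + 1), expIncrement n ℓ j = Real.exp (n * (ℓ * M)) := by
  induction M with
  | zero => simp [expIncrement]
  | succ M ih => rw [Finset.sum_range_succ, ih, expIncrement]; ring

theorem abs_exp_mul_simplexSum_singleton_sub_one_le (n : ℕ) {ℓ τ : ℝ} (hℓ : 0 < ℓ) (hτ : 0 ≤ τ) :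
    |Real.exp (-(n * τ)) * simplexSum n [ℓ] τ - 1| ≤ 1 - Real.exp (-(n * ℓ)) := by
  have h0 := sub_mul_nonneg_of_le_floor hτ hℓ (le_refl ⌊τ / ℓ⌋₊)
  have h1 : τ - ℓ * ⌊τ / ℓ⌋₊ ≤ ℓ := by
    have := Nat.lt_floor_add_one (τ / ℓ)
    rw [div_lt_iff₀ hℓ] at this
    linarith
  have hn : (0 : ℝ) ≤ n := n.cast_nonneg
  simp only [simplexSum, mul_one]
  rw [sum_expIncrement, ← Real.exp_add]
  have h2 : -(n * τ) + n * (ℓ * ⌊τ / ℓ⌋₊) = -(n * (τ - ℓ * ⌊τ / ℓ⌋₊)) := by ring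
  rw [h2, abs_sub_comm, abs_of_nonneg]
  · gcongr
  · rw [sub_nonneg, Real.exp_le_one_iff, neg_nonpos]
    positivity

theorem one_sub_exp_neg_le (x : ℝ) : 1 - Real.exp (-x) ≤ x := by
  linarith [Real.add_one_le_exp (-x)]

/-- Asymptotics of `simplexSum`. The numbers `x.2` approximate the densities
`(1 - exp (-n ℓ)) / ℓ` up to `ε`. -/
theorem exists_abs_exp_mul_simplexSum_sub_le (n : ℕ) {R : ℝ} (hR : 0 ≤ R) (p : ℕ) :
    ∃ K : ℝ, 0 ≤ K ∧ ∀ (L : List (ℝ × ℝ)) (ℓ₀ ε : ℝ), L.length = p →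
      (∀ x ∈ L, 0 < x.1 ∧ 0 ≤ x.2 ∧ x.2 ≤ n ∧ |(1 - Real.exp (-(n * x.1))) / x.1 - x.2| ≤ ε) →
      0 < ℓ₀ → 1 - Real.exp (-(n * ℓ₀)) ≤ ε → ε ≤ R → ∀ τ : ℝ, 0 ≤ τ →
        |Real.exp (-(n * τ)) * simplexSum n (L.map Prod.fst ++ [ℓ₀]) τ -
            (L.map Prod.snd).prod * (τ ^ p / p.factorial)| ≤
          K * (p * (1 + τ) ^ (p - 1) + ε * (1 + τ) ^ p) := by
  induction p with
  | zero =>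
    refine ⟨1, zero_le_one, fun L ℓ₀ ε hL _ hℓ₀ hε _ τ hτ => ?_⟩
    obtain rfl := List.length_eq_zero_iff.mp hL
    simpa using (abs_exp_mul_simplexSum_singleton_sub_one_le n hℓ₀ hτ).trans hε
  | succ p ih =>
    obtain ⟨K, hK, ih⟩ := ih
    refine ⟨(n + 1) * K * (p + 1) + 2 * n ^ p + K * (p + R), by positivity,
      fun L ℓ₀ ε hL hx hℓ₀ hε hεR τ hτ => ?_⟩
    obtain _ | ⟨⟨ℓ, β⟩, L⟩ := L
    · simp at hL
    obtain ⟨hℓ, hβ0, hβn, hβ⟩ := hx (ℓ, β) (by simp)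
    simp only at hℓ hβ0 hβn hβ
    replace hL : L.length = p := by simpa using hL
    replace hx : ∀ x ∈ L, _ := fun x h => hx x (by simp [h])
    have ih' := ih L ℓ₀ ε hL hx hℓ₀ hε hεR
    have hn : (0 : ℝ) ≤ n := n.cast_nonneg
    have hε0 : 0 ≤ ε := (abs_nonneg _).trans hβ
    rw [List.map_cons, List.cons_append, List.map_cons, List.prod_cons]
    set A := (L.map Prod.snd).prod with hA
    have hA0 : 0 ≤ A := List.prod_nonneg fun x h => by
      obtain ⟨y, hy, rfl⟩ := List.mem_map.mp h
      exact (hx y hy).2.1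
    have hAn : A ≤ n ^ p := by
      rw [hA, ← hL]
      clear hA hA0 ih' hL ih
      induction L with
      | nil => simp
      | cons y L ihL =>
        have hy := hx y (by simp)
        simp only [List.map_cons, List.prod_cons, List.length_cons, pow_succ']
        refine mul_le_mul hy.2.2.1 (ihL fun x h => hx x (by simp [h])) ?_ hn
        exact List.prod_nonneg fun x h => by
          obtain ⟨z, hz, rfl⟩ := List.mem_map.mp h
          exact (hx z (by simp [hz])).2.1
    set G : ℝ → ℝ := fun σ => Real.exp (-(n * σ)) * simplexSum n (L.map Prod.fst ++ [ℓ₀]) σ with hG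
    set e : ℝ := K * (p * (1 + τ) ^ (p - 1) + ε * (1 + τ) ^ p) with he
    have he0 : 0 ≤ e := by positivity
    set θ := 1 - Real.exp (-(n * ℓ)) with hθ
    have hθ0 : 0 ≤ θ := by
      rw [hθ, sub_nonneg, Real.exp_le_one_iff, neg_nonpos]; positivity
    have hθ1 : θ ≤ 1 := by
      rw [hθ]; linarith [Real.exp_pos (-(n * ℓ))]
    have hθn : θ ≤ n * ℓ := one_sub_exp_neg_le _
    have hexp : Real.exp (-(n * ℓ)) = 1 - θ := by rw [hθ]; ring
    rw [exp_mul_simplexSum_cons, ← hθ, hexp]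
    set M := ⌊τ / ℓ⌋₊ with hM
    have hMℓ : (M : ℝ) * ℓ ≤ τ := by
      have := Nat.floor_le (div_nonneg hτ hℓ.le)
      rwa [le_div_iff₀ hℓ] at this
    have herr : ∀ j ∈ Finset.range (M + 1),
        |G (τ - ℓ * j) - A * ((τ - ℓ * j) ^ p / p.factorial)| ≤ e := by
      intro j hj
      have hj0 := sub_mul_nonneg_of_le_floor hτ hℓ (Nat.lt_succ_iff.mp (Finset.mem_range.mp hj))
      refine (ih' _ hj0).trans ?_
      have hle : τ - ℓ * j ≤ τ := by
        have : 0 ≤ ℓ * (j : ℝ) := by positivity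
        linarith
      rw [he]
      gcongr
    have hfact : (0 : ℝ) < p.factorial := by exact_mod_cast p.factorial_pos
    have hfact1 : (1 : ℝ) ≤ p.factorial := by exact_mod_cast p.factorial_pos
    have hτ1 : (1 : ℝ) ≤ 1 + τ := by linarith
    have hτp : τ ^ p / p.factorial ≤ (1 + τ) ^ p :=
      (div_le_self (by positivity) hfact1).trans (by gcongr; linarith)
    have hsum1 : |∑ j ∈ Finset.range (M + 1), G (τ - ℓ * j) -
        A / p.factorial * ∑ j ∈ Finset.range (M + 1), (τ - ℓ * j) ^ p| ≤ (M + 1) * e := by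
      rw [Finset.mul_sum, ← Finset.sum_sub_distrib]
      refine (Finset.abs_sum_le_sum_abs _ _).trans ?_
      have := Finset.sum_le_card_nsmul _ _ _ herr
      rw [Finset.card_range, nsmul_eq_mul] at this
      push_cast at this
      refine le_trans (le_of_eq ?_) this
      refine Finset.sum_congr rfl fun j _ => ?_
      congr 2
      ring
    set S₁ := ∑ j ∈ Finset.range (M + 1), G (τ - ℓ * j) with hS₁
    set S₂ := ∑ j ∈ Finset.range (M + 1), (τ - ℓ * (j : ℝ)) ^ p with hS₂
    have hsum2 := abs_sum_pow_sub_le hτ hℓ p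
    rw [← hM, ← hS₂] at hsum2
    change |θ * S₁ + (1 - θ) * G τ - β * A * (τ ^ (p + 1) / ((p + 1).factorial : ℕ))| ≤ _
    have hfs : (((p + 1).factorial : ℕ) : ℝ) = (p + 1) * p.factorial := by
      rw [Nat.factorial_succ]; push_cast; ring
    have hsplit : θ * S₁ + (1 - θ) * G τ - β * A * (τ ^ (p + 1) / ((p + 1).factorial : ℕ)) =
        θ * (S₁ - A / p.factorial * S₂) +
        θ / ℓ * (A / p.factorial) * (ℓ * S₂ - τ ^ (p + 1) / (p + 1)) +
        (θ / ℓ - β) * (A * (τ ^ (p + 1) / ((p + 1).factorial : ℕ))) +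
        (1 - θ) * (G τ - A * (τ ^ p / p.factorial)) + (1 - θ) * (A * (τ ^ p / p.factorial)) := by
      rw [hfs]
      field_simp
      ring
    have b1 : |θ * (S₁ - A / p.factorial * S₂)| ≤ (n + 1) * (1 + τ) * e := by
      rw [abs_mul, abs_of_nonneg hθ0]
      calc θ * _ ≤ θ * ((M + 1) * e) := mul_le_mul_of_nonneg_left hsum1 hθ0
        _ = (θ * M + θ) * e := by ring
        _ ≤ (n * ℓ * M + 1) * e := by gcongr
        _ ≤ ((n + 1) * (1 + τ)) * e := by
          refine mul_le_mul_of_nonneg_right ?_ he0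
          have := mul_le_mul_of_nonneg_left hMℓ hn
          nlinarith
    have b2 : |θ / ℓ * (A / p.factorial) * (ℓ * S₂ - τ ^ (p + 1) / (p + 1))| ≤
        n ^ p * (1 + τ) ^ p := by
      rw [abs_mul, abs_of_nonneg (by positivity)]
      calc _ ≤ θ / ℓ * (A / p.factorial) * (ℓ * τ ^ p) := by gcongr
        _ = θ * (A * (τ ^ p / p.factorial)) := by field_simp
        _ ≤ 1 * (n ^ p * (1 + τ) ^ p) := by gcongr
        _ = _ := one_mul _
    have b3 : |(θ / ℓ - β) * (A * (τ ^ (p + 1) / ((p + 1).factorial : ℕ)))| ≤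
        ε * (n ^ p * (1 + τ) ^ (p + 1)) := by
      have h1 : (1 : ℝ) ≤ ((p + 1).factorial : ℕ) := by exact_mod_cast (p + 1).factorial_pos
      rw [abs_mul, abs_of_nonneg (a := A * _) (by positivity)]
      have h2 : τ ^ (p + 1) / ((p + 1).factorial : ℕ) ≤ (1 + τ) ^ (p + 1) :=
        (div_le_self (by positivity) h1).trans (by gcongr; linarith)
      gcongr
    have b4 : |(1 - θ) * (G τ - A * (τ ^ p / p.factorial))| ≤ K * (p + R) * (1 + τ) ^ p := by
      rw [abs_mul, abs_of_nonneg (by linarith)]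
      calc _ ≤ 1 * (K * (p * (1 + τ) ^ (p - 1) + ε * (1 + τ) ^ p)) := by
            refine mul_le_mul (by linarith) (ih' τ hτ) (abs_nonneg _) zero_le_one
        _ ≤ 1 * (K * (p * (1 + τ) ^ p + R * (1 + τ) ^ p)) := by
            gcongr
            omega
        _ = _ := by ring
    have b5 : |(1 - θ) * (A * (τ ^ p / p.factorial))| ≤ n ^ p * (1 + τ) ^ p := by
      rw [abs_mul, abs_of_nonneg (by linarith), abs_of_nonneg (by positivity)]
      calc _ ≤ 1 * (n ^ p * (1 + τ) ^ p) := by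
            refine mul_le_mul (by linarith) ?_ (by positivity) zero_le_one
            gcongr
        _ = _ := one_mul _
    have he' : (1 + τ) * e = K * (p * (1 + τ) ^ p + ε * (1 + τ) ^ (p + 1)) := by
      rw [he]
      rcases p with _ | p
      · simp; ring
      · rw [Nat.add_sub_cancel]; ring
    rw [hsplit]
    have habs : ∀ a b c d f : ℝ, |a + b + c + d + f| ≤ |a| + |b| + |c| + |d| + |f| := by
      intro a b c d f
      linarith [abs_add_le (a + b + c + d) f, abs_add_le (a + b + c) d, abs_add_le (a + b) c,
        abs_add_le a b]
    refine (habs _ _ _ _ _).trans ?_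
    rw [mul_assoc, he'] at b1
    rw [Nat.add_sub_cancel]
    set P := (1 + τ) ^ p with hP
    set Q := (1 + τ) ^ (p + 1) with hQ
    have hP0 : 0 ≤ P := by positivity
    have hQ0 : 0 ≤ Q := by positivity
    refine (add_le_add (add_le_add (add_le_add (add_le_add b1 b2) b3) b4) b5).trans ?_
    have hnp : (0 : ℝ) ≤ n ^ p := by positivity
    have hp0 : (0 : ℝ) ≤ p := p.cast_nonneg
    push_cast
    have hnK : 0 ≤ (n : ℝ) * K := by positivity
    rw [← sub_nonneg]
    have hfinal : (((n : ℝ) + 1) * K * (p + 1) + 2 * n ^ p + K * (p + R)) * ((p + 1) * P + ε * Q) -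
        ((n + 1) * (K * (p * P + ε * Q)) + n ^ p * P + ε * (n ^ p * Q) + K * (p + R) * P +
          n ^ p * P) =
        (n + 1) * K * (p * p + p + 1) * P + 2 * n ^ p * p * P + K * (p + R) * p * P +
        ((n + 1) * K * p + n ^ p + K * (p + R)) * (ε * Q) := by ring
    rw [hfinal]
    positivity

end SimplexAsymptotics

section CountAsymptotics

theorem exp_neg_le_one_sub_add_sq {x : ℝ} (hx : 0 ≤ x) : Real.exp (-x) ≤ 1 - x + x ^ 2 := by
  rcases le_or_gt x 1 with h | h
  · have := (abs_le.mp (Real.abs_exp_sub_one_sub_id_le (x := -x)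
      (by rwa [abs_neg, abs_of_nonneg hx]))).2
    rw [neg_sq] at this
    linarith
  · have : Real.exp (-x) ≤ 1 := Real.exp_le_one_iff.mpr (by linarith)
    nlinarith

theorem one_sub_exp_div_le (n : ℕ) {ℓ : ℝ} (hℓ : 0 < ℓ) :
    (1 - Real.exp (-(n * ℓ))) / ℓ ≤ n := by
  rw [div_le_iff₀ hℓ]
  exact one_sub_exp_neg_le _

theorem one_sub_exp_div_nonneg (n : ℕ) {ℓ : ℝ} (hℓ : 0 < ℓ) :
    0 ≤ (1 - Real.exp (-(n * ℓ))) / ℓ := by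
  refine div_nonneg ?_ hℓ.le
  rw [sub_nonneg, Real.exp_le_one_iff, neg_nonpos]
  positivity

theorem abs_one_sub_exp_div_sub_le (n : ℕ) {ℓ : ℝ} (hℓ : 0 < ℓ) :
    |(1 - Real.exp (-(n * ℓ))) / ℓ - n| ≤ n ^ 2 * ℓ := by
  have h1 := one_sub_exp_div_le n hℓ
  rw [abs_sub_comm, abs_of_nonneg (by linarith), sub_le_iff_le_add, ← sub_le_iff_le_add',
    le_div_iff₀ hℓ]
  have := exp_neg_le_one_sub_add_sq (x := n * ℓ) (by positivity)
  nlinarith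

/-- The constant in the error term of `abs_ncard_simplex_sub_le`. -/
noncomputable def simplexErrorConst (n m p : ℕ) (K C₁ c₁ : ℝ) : ℝ :=
  let J : ℝ := p + 1
  let D : ℝ := (1 + J) / Real.log 2 + m
  c₁ * (K * (p * D ^ (p - 1) + n ^ 2 * (D ^ p * (2 * J)))) * Real.exp (n * J) +
    C₁ * Real.exp (n * J) * ((2 * D / Real.log 2) ^ (p + 1) * (2 * J) ^ (p + 1)) /
      Real.log 2 ^ (p - 1)

theorem one_add_le_mul_of_log_two_le {m p : ℕ} {u σ : ℝ} (hu : Real.log 2 ≤ u)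
    (hσ : σ ≤ m * u + (p + 1)) :
    1 + σ ≤ ((1 + (p + 1)) / Real.log 2 + m) * u := by
  have hlog : 0 < Real.log 2 := Real.log_pos one_lt_two
  have h1 : (1 + (p + 1) : ℝ) ≤ (1 + (p + 1)) / Real.log 2 * u := by
    rw [div_mul_eq_mul_div, le_div_iff₀ hlog]
    gcongr
  linarith

theorem mul_exp_neg_div_le {u : ℝ} (p : ℕ) :
    Real.exp (-(u / (2 * (p + 1)))) * u ≤ 2 * (p + 1) := by
  have h1 := Real.add_one_le_exp (u / (2 * (p + 1)))
  have hp : (0 : ℝ) < 2 * (p + 1) := by positivity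
  have h2 : u ≤ Real.exp (u / (2 * (p + 1))) * (2 * (p + 1)) := by
    rw [← div_le_iff₀ hp]; linarith
  calc _ ≤ Real.exp (-(u / (2 * (p + 1)))) * (Real.exp (u / (2 * (p + 1))) * (2 * (p + 1))) := by
        gcongr
    _ = 2 * (p + 1) := by rw [← mul_assoc, ← Real.exp_add]; simp

variable {Ω ι : Type*} [Fintype ι] [DecidableEq ι]

/-- Count of the points in a simplex, given the count in boxes. -/
theorem abs_ncard_simplex_sub_le (n m p : ℕ) (hn : 0 < n) (hm : 0 < m) (hp : 0 < p)
    {K C₁ c₁ : ℝ} (hK0 : 0 ≤ K) (hC₁ : 0 ≤ C₁)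
    (hK : ∀ (L : List (ℝ × ℝ)) (ℓ₀ ε : ℝ), L.length = p →
      (∀ x ∈ L, 0 < x.1 ∧ 0 ≤ x.2 ∧ x.2 ≤ n ∧ |(1 - Real.exp (-(n * x.1))) / x.1 - x.2| ≤ ε) →
      0 < ℓ₀ → 1 - Real.exp (-(n * ℓ₀)) ≤ ε → ε ≤ n ^ 2 → ∀ τ : ℝ, 0 ≤ τ →
        |Real.exp (-(n * τ)) * simplexSum n (L.map Prod.fst ++ [ℓ₀]) τ -
            (L.map Prod.snd).prod * (τ ^ p / p.factorial)| ≤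
          K * (p * (1 + τ) ^ (p - 1) + ε * (1 + τ) ^ p))
    (hcard : Fintype.card ι = p + 1) (v₀ : ι) {u η c : ℝ} (hu : Real.log 2 ≤ u)
    (hη : η = Real.exp (-(u / (2 * (p + 1))))) (hc : 0 ≤ c) (hcc : c ≤ c₁)
    {κ : Ω → ι → ℕ} {ℓ β : ι → ℝ} (hv₀ : ℓ v₀ = η)
    (hℓ : ∀ v, (ℓ v = η ∧ β v = n) ∨
      (Real.log 2 ≤ ℓ v ∧ β v = (1 - Real.exp (-(n * ℓ v))) / ℓ v))
    (hfin : ∀ i : ι → ℕ, {a | ∀ v, κ a v ≤ i v}.Finite)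
    (hbox : ∀ i : ι → ℕ,
      |({a | ∀ v, κ a v ≤ i v}.ncard : ℝ) - c * Real.exp (n * ∑ v, ℓ v * i v)| ≤
        C₁ * Real.exp ((n - 1 / m) * ∑ v, ℓ v * i v))
    {σ : ℝ} (hσ0 : 0 ≤ σ) (hσ : σ ≤ m * u + (p + 1)) :
    |({a | ∑ v, ℓ v * κ a v ≤ σ}.ncard : ℝ) -
        c * Real.exp (n * σ) * ((∏ v ∈ Finset.univ.erase v₀, β v) * (σ ^ p / p.factorial))| ≤
      simplexErrorConst n m p K C₁ c₁ * (Real.exp (n * (m * u)) * u ^ (p - 1)) := by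
  have hlog : 0 < Real.log 2 := Real.log_pos one_lt_two
  have hlog1 : Real.log 2 ≤ 1 := by linarith [Real.log_two_lt_d9]
  have hu0 : 0 < u := hlog.trans_le hu
  have hη0 : 0 < η := hη ▸ Real.exp_pos _
  have hη1 : η ≤ 1 := by
    rw [hη, Real.exp_le_one_iff, neg_nonpos]; positivity
  have hℓ0 : ∀ v, 0 < ℓ v := fun v => by
    rcases hℓ v with h | h
    · rw [h.1]; exact hη0
    · exact hlog.trans_le h.1
  have hn1 : (1 : ℝ) ≤ n := by exact_mod_cast hn
  have hm1 : (1 : ℝ) ≤ m := by exact_mod_cast hm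
  have hm0 : (0 : ℝ) < m := by linarith
  have hexpo : 0 ≤ (n : ℝ) - 1 / m := by
    rw [sub_nonneg, div_le_iff₀ hm0]; nlinarith
  have hc₁ : 0 ≤ c₁ := hc.trans hcc
  set J : ℝ := p + 1 with hJ
  have hJ0 : 0 < J := by positivity
  set D : ℝ := (1 + J) / Real.log 2 + m with hD
  have hD0 : 0 < D := by positivity
  have hσD : 1 + σ ≤ D * u := one_add_le_mul_of_log_two_le hu hσ
  have hηu : η * u ≤ 2 * J := hη ▸ mul_exp_neg_div_le p
  set l := (Finset.univ.erase v₀).toList ++ [v₀] with hl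
  have hlmem : ∀ v, v ∈ l := fun v => by
    by_cases h : v = v₀ <;> simp [hl, h]
  have hlnodup : l.Nodup := by
    rw [hl, List.nodup_append]
    refine ⟨Finset.nodup_toList _, by simp, ?_⟩
    intro a ha b hb
    simp only [Finset.mem_toList, Finset.mem_erase] at ha
    simp only [List.mem_singleton] at hb
    exact hb ▸ ha.1
  have hlsum : ∀ f : ι → ℝ, (l.map f).sum = ∑ v, f v := by
    intro f
    rw [hl, List.map_append, List.sum_append, Finset.sum_map_toList]
    simp
  have hlprod : ∀ f : ι → ℝ, (l.map f).prod = ∏ v, f v := by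
    intro f
    rw [hl, List.map_append, List.prod_append, Finset.prod_map_toList]
    simp [Finset.prod_erase_mul]
  have hregion : ∀ i, mixedRegion κ ℓ l i σ = {a | ∑ v, ℓ v * κ a v ≤ σ} := by
    intro i
    ext a
    simp [mixedRegion, hlmem, hlsum]
  set E := C₁ * Real.exp ((n - 1 / m) * σ) with hE
  have hcount := abs_ncard_mixedRegion_sub_le hℓ0 hfin n (B := σ) (E := E) (c := c) (by positivity)
    (fun i hi => (hbox i).trans (by rw [hE]; gcongr)) l hlnodup (fun _ => 0) hσ0 (by simp)
  rw [hregion] at hcount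
  simp only [CharP.cast_eq_zero, mul_zero, Finset.sum_const_zero, Real.exp_zero, mul_one,
    hlprod] at hcount
  set L := (Finset.univ.erase v₀).toList.map fun v => (ℓ v, β v) with hL
  have hLfst : L.map Prod.fst ++ [ℓ v₀] = l.map ℓ := by simp [hL, hl]
  have hLsnd : (L.map Prod.snd).prod = ∏ v ∈ Finset.univ.erase v₀, β v := by
    rw [hL, List.map_map, ← Finset.prod_map_toList]; rfl
  have hLlen : L.length = p := by simp [hL, hcard]
  have hasy := hK L (ℓ v₀) (n ^ 2 * η) hLlen ?_ (hℓ0 _) ?_ ?_ σ hσ0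
  · rw [hLfst, hLsnd] at hasy
    set A := ∏ v ∈ Finset.univ.erase v₀, β v with hA
    set S := simplexSum n (l.map ℓ) σ with hS
    have hmain : |c * S - c * Real.exp (n * σ) * (A * (σ ^ p / p.factorial))| ≤
        c₁ * (K * (p * D ^ (p - 1) + n ^ 2 * (D ^ p * (2 * J)))) * Real.exp (n * J) *
          (Real.exp (n * (m * u)) * u ^ (p - 1)) := by
      have h1 : c * S - c * Real.exp (n * σ) * (A * (σ ^ p / p.factorial)) =
          c * Real.exp (n * σ) *
            (Real.exp (-(n * σ)) * S - A * (σ ^ p / p.factorial)) := by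
        have : Real.exp (n * σ) * Real.exp (-(n * σ)) = 1 := by rw [← Real.exp_add]; simp
        linear_combination (-(c * S)) * this
      rw [h1, abs_mul, abs_of_nonneg (by positivity)]
      have h2 : Real.exp (n * σ) ≤ Real.exp (n * J) * Real.exp (n * (m * u)) := by
        rw [← Real.exp_add, Real.exp_le_exp]; nlinarith
      have h3 : K * (p * (1 + σ) ^ (p - 1) + n ^ 2 * η * (1 + σ) ^ p) ≤
          K * (p * D ^ (p - 1) + n ^ 2 * (D ^ p * (2 * J))) * u ^ (p - 1) := by
        have h4 : (1 + σ) ^ (p - 1) ≤ D ^ (p - 1) * u ^ (p - 1) := by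
          rw [← mul_pow]; gcongr
        have h5 : η * (1 + σ) ^ p ≤ D ^ p * (2 * J) * u ^ (p - 1) := by
          calc η * (1 + σ) ^ p ≤ η * (D * u) ^ p := by gcongr
            _ = D ^ p * (η * u) * u ^ (p - 1) := by
              have : u ^ p = u * u ^ (p - 1) := by rw [← pow_succ', Nat.sub_add_cancel hp]
              rw [mul_pow, this]; ring
            _ ≤ _ := by gcongr
        calc _ = K * (p * (1 + σ) ^ (p - 1) + n ^ 2 * (η * (1 + σ) ^ p)) := by ring
          _ ≤ K * (p * (D ^ (p - 1) * u ^ (p - 1)) +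
              n ^ 2 * (D ^ p * (2 * J) * u ^ (p - 1))) := by gcongr
          _ = _ := by ring
      calc _ ≤ c₁ * (Real.exp (n * J) * Real.exp (n * (m * u))) *
            (K * (p * D ^ (p - 1) + n ^ 2 * (D ^ p * (2 * J))) * u ^ (p - 1)) := by
            exact mul_le_mul (by gcongr) (hasy.trans h3) (abs_nonneg _) (by positivity)
        _ = _ := by ring
    have herr : E * ∏ v, 2 * (1 + σ / ℓ v) ≤
        C₁ * Real.exp (n * J) * ((2 * D / Real.log 2) ^ (p + 1) * (2 * J) ^ (p + 1)) /
          Real.log 2 ^ (p - 1) * (Real.exp (n * (m * u)) * u ^ (p - 1)) := by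
      have h1 : E ≤ C₁ * (Real.exp (n * J) * Real.exp (n * (m * u)) * Real.exp (-u)) := by
        rw [hE, ← Real.exp_add, ← Real.exp_add]
        gcongr
        have h2 : (n - 1 / m : ℝ) * σ ≤ (n - 1 / m) * (m * u + J) :=
          mul_le_mul_of_nonneg_left hσ hexpo
        have h3 : (n - 1 / m : ℝ) * (m * u + J) = n * (m * u) - u + n * J - J / m := by
          field_simp
          ring
        have h4 : 0 ≤ J / m := by positivity
        linarith
      have h2 : ∏ v, 2 * (1 + σ / ℓ v) ≤ (2 * D / Real.log 2 * (u / η)) ^ (p + 1) := by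
        rw [← hcard, ← Finset.card_univ, ← Finset.prod_const]
        refine Finset.prod_le_prod (fun v _ => ?_) fun v _ => ?_
        · have := (hℓ0 v).le
          positivity
        · have hlow : η * Real.log 2 ≤ ℓ v := by
            rcases hℓ v with h | h
            · rw [h.1]; exact mul_le_of_le_one_right hη0.le hlog1
            · exact (mul_le_of_le_one_left hlog.le hη1).trans h.1
          have hpos : 0 < η * Real.log 2 := by positivity
          have hle1 : η * Real.log 2 ≤ 1 := mul_le_one₀ hη1 hlog.le hlog1
          calc 2 * (1 + σ / ℓ v) ≤ 2 * (1 / (η * Real.log 2) + σ / (η * Real.log 2)) := by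
                gcongr
                rw [le_div_iff₀ hpos]; linarith
            _ = 2 * ((1 + σ) / (η * Real.log 2)) := by rw [← add_div]
            _ ≤ 2 * (D * u / (η * Real.log 2)) := by gcongr
            _ = _ := by field_simp
      have h3 : (u / η) ^ (p + 1) * Real.exp (-u) ≤ (2 * J) ^ (p + 1) := by
        have h4 : Real.exp (-u) = (η * η) ^ (p + 1) := by
          rw [hη, ← Real.exp_add, ← Real.exp_nat_mul]
          congr 1
          push_cast
          rw [← hJ]
          field_simp
          ring
        rw [h4, ← mul_pow]
        have h5 : u / η * (η * η) = η * u := by field_simp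
        rw [h5]
        gcongr
      have h6 : 1 ≤ u ^ (p - 1) / Real.log 2 ^ (p - 1) := by
        rw [one_le_div (by positivity)]; gcongr
      calc _ ≤ C₁ * (Real.exp (n * J) * Real.exp (n * (m * u)) * Real.exp (-u)) *
            (2 * D / Real.log 2 * (u / η)) ^ (p + 1) := by
            refine mul_le_mul h1 h2 ?_ (by positivity)
            refine Finset.prod_nonneg fun v _ => ?_
            have := (hℓ0 v).le
            positivity
        _ = C₁ * Real.exp (n * J) * Real.exp (n * (m * u)) * (2 * D / Real.log 2) ^ (p + 1) *
            ((u / η) ^ (p + 1) * Real.exp (-u)) := by rw [mul_pow]; ring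
        _ ≤ C₁ * Real.exp (n * J) * Real.exp (n * (m * u)) * (2 * D / Real.log 2) ^ (p + 1) *
            (2 * J) ^ (p + 1) := by gcongr
        _ ≤ C₁ * Real.exp (n * J) * Real.exp (n * (m * u)) * (2 * D / Real.log 2) ^ (p + 1) *
            (2 * J) ^ (p + 1) * (u ^ (p - 1) / Real.log 2 ^ (p - 1)) :=
            le_mul_of_one_le_right (by positivity) h6
        _ = _ := by ring
    have htri := abs_sub_le ({a | ∑ v, ℓ v * (κ a v : ℝ) ≤ σ}.ncard : ℝ) (c * S)
      (c * Real.exp (n * σ) * (A * (σ ^ p / p.factorial)))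
    refine htri.trans ((add_le_add (hcount.trans herr) hmain).trans (le_of_eq ?_))
    simp only [simplexErrorConst, ← hJ, ← hD]
    ring
  · intro x hx
    obtain ⟨v, -, rfl⟩ := List.mem_map.mp hx
    refine ⟨hℓ0 v, ?_⟩
    rcases hℓ v with h | h
    · simp only [h.1, h.2]
      exact ⟨by positivity, le_rfl, abs_one_sub_exp_div_sub_le n hη0⟩
    · simp only [h.2]
      refine ⟨one_sub_exp_div_nonneg n (hℓ0 v), one_sub_exp_div_le n (hℓ0 v), ?_⟩
      rw [sub_self, abs_zero]; positivity
  · rw [hv₀]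
    refine (one_sub_exp_neg_le _).trans ?_
    gcongr
    nlinarith
  · exact mul_le_of_le_one_right (by positivity) hη1

/-- Comparison of the main terms at `τ` and at `σ`. -/
theorem exp_mul_pow_sub_le (n p : ℕ) {τ σ : ℝ} (hτ : 0 ≤ τ) (hσ : τ ≤ σ) :
    Real.exp (n * σ) * σ ^ p - Real.exp (n * τ) * τ ^ p ≤
      Real.exp (n * σ) * ((σ - τ) * (n * (1 + σ) ^ p + p * (1 + σ) ^ (p - 1))) := by
  have hd : 0 ≤ σ - τ := sub_nonneg.mpr hσ
  have hσ0 : 0 ≤ σ := hτ.trans hσ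
  have h1 : Real.exp (n * σ) - Real.exp (n * τ) ≤ Real.exp (n * σ) * (n * (σ - τ)) := by
    have h2 := mul_le_mul_of_nonneg_left (one_sub_exp_neg_le (n * (σ - τ)))
      (Real.exp_pos (n * σ)).le
    rw [mul_sub, mul_one, ← Real.exp_add] at h2
    have h3 : n * σ + -(n * (σ - τ)) = n * τ := by ring
    rwa [h3] at h2
  have h4 : σ ^ p - τ ^ p ≤ (σ - τ) * (p * (1 + σ) ^ (p - 1)) := by
    rcases p with _ | p
    · simp
    · have := pow_succ_sub_pow_succ_le hτ hd p
      rw [add_sub_cancel] at this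
      refine this.trans ?_
      rw [Nat.add_sub_cancel, mul_comm ((p : ℝ) + 1), mul_assoc]
      push_cast
      gcongr
      linarith
  calc _ = (Real.exp (n * σ) - Real.exp (n * τ)) * σ ^ p +
        Real.exp (n * τ) * (σ ^ p - τ ^ p) := by ring
    _ ≤ Real.exp (n * σ) * (n * (σ - τ)) * (1 + σ) ^ p +
        Real.exp (n * σ) * ((σ - τ) * (p * (1 + σ) ^ (p - 1))) := by
        refine add_le_add (mul_le_mul h1 ?_ (by positivity) (by positivity))
          (mul_le_mul (by gcongr) h4 ?_ (by positivity))
        · gcongr; linarith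
        · rw [sub_nonneg]; gcongr
    _ = _ := by ring

/-- Count of the points of bounded height, given the count in boxes. The function `h` plays the role
of the logarithmic height, and is approximated by `∑ v, ℓ v * κ a v`. -/
theorem exists_abs_ncard_le_height_sub_le (n m p : ℕ) (hn : 0 < n) (hm : 0 < m) (hp : 0 < p)
    {C₁ c₁ : ℝ} (hC₁ : 0 ≤ C₁) :
    ∃ C : ℝ, ∀ {Ω ι : Type*} [Fintype ι] [DecidableEq ι], Fintype.card ι = p + 1 →
      ∀ (v₀ : ι) {u η c : ℝ}, Real.log 2 ≤ u → η = Real.exp (-(u / (2 * (p + 1)))) →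
      0 ≤ c → c ≤ c₁ → ∀ {κ : Ω → ι → ℕ} {ℓ β : ι → ℝ} {h : Ω → ℝ}, ℓ v₀ = η →
      (∀ v, (ℓ v = η ∧ β v = n) ∨
        (Real.log 2 ≤ ℓ v ∧ β v = (1 - Real.exp (-(n * ℓ v))) / ℓ v)) →
      (∀ i : ι → ℕ, {a | ∀ v, κ a v ≤ i v}.Finite) →
      (∀ i : ι → ℕ,
        |({a | ∀ v, κ a v ≤ i v}.ncard : ℝ) - c * Real.exp (n * ∑ v, ℓ v * i v)| ≤
          C₁ * Real.exp ((n - 1 / m) * ∑ v, ℓ v * i v)) →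
      (∀ a, h a ≤ ∑ v, ℓ v * κ a v) → (∀ a, ∑ v, ℓ v * κ a v ≤ h a + (p + 1) * η) →
      {a | h a ≤ m * u}.Finite ∧
      |({a | h a ≤ m * u}.ncard : ℝ) - c * Real.exp (n * (m * u)) *
          ((∏ v ∈ Finset.univ.erase v₀, β v) * ((m * u) ^ p / p.factorial))| ≤
        C * (Real.exp (n * (m * u)) * u ^ (p - 1)) := by
  obtain ⟨K, hK0, hK⟩ := exists_abs_exp_mul_simplexSum_sub_le n (R := (n : ℝ) ^ 2)
    (by positivity) p
  let J : ℝ := p + 1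
  let D : ℝ := (1 + J) / Real.log 2 + m
  refine ⟨simplexErrorConst n m p K C₁ c₁ + c₁ * n ^ p * (Real.exp (n * J) *
    (J * (n * (D ^ p * (2 * J)) + p * D ^ (p - 1)))), ?_⟩
  intro Ω ι _ _ hcard v₀ u η c hu hη hc hcc κ ℓ β h hv₀ hℓ hfin hbox hle hge
  have hlog : 0 < Real.log 2 := Real.log_pos one_lt_two
  have hu0 : 0 < u := hlog.trans_le hu
  have hη0 : 0 < η := hη ▸ Real.exp_pos _
  have hη1 : η ≤ 1 := by
    rw [hη, Real.exp_le_one_iff, neg_nonpos]; positivity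
  have hℓ0 : ∀ v, 0 < ℓ v := fun v => by
    rcases hℓ v with h | h
    · rw [h.1]; exact hη0
    · exact hlog.trans_le h.1
  have hβ0 : ∀ v, 0 ≤ β v := fun v => by
    rcases hℓ v with h | h
    · rw [h.2]; positivity
    · rw [h.2]; exact one_sub_exp_div_nonneg n (hℓ0 v)
  have hβn : ∀ v, β v ≤ n := fun v => by
    rcases hℓ v with h | h
    · rw [h.2]
    · rw [h.2]; exact one_sub_exp_div_le n (hℓ0 v)
  have hc₁ : 0 ≤ c₁ := hc.trans hcc
  have hJ0 : 0 < J := by positivity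
  have hD0 : 0 < D := by positivity
  have hηu : η * u ≤ 2 * J := hη ▸ mul_exp_neg_div_le p
  set τ : ℝ := m * u with hτ
  have hτ0 : 0 ≤ τ := by positivity
  set σ : ℝ := τ + J * η with hσ
  have hJη : J * η ≤ J := mul_le_of_le_one_right hJ0.le hη1
  have hJη0 : 0 ≤ J * η := by positivity
  have hσJ : σ ≤ τ + J := by linarith
  have hτσ : τ ≤ σ := by linarith
  have hσ0 : 0 ≤ σ := hτ0.trans hτσ
  have hσD : 1 + σ ≤ D * u := one_add_le_mul_of_log_two_le hu hσJ
  have key := fun {σ : ℝ} => abs_ncard_simplex_sub_le n m p hn hm hp hK0 hC₁ hK hcard v₀ hu hη hc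
    hcc hv₀ hℓ hfin hbox (σ := σ)
  have k1 := key hτ0 (by linarith)
  have k2 := key hσ0 hσJ
  have hT : ∀ σ : ℝ, {a | ∑ v, ℓ v * (κ a v : ℝ) ≤ σ}.Finite := by
    intro σ
    refine (finite_mixedRegion hℓ0 hfin Finset.univ.toList (fun _ => 0) σ).subset fun a ha => ?_
    refine ⟨fun v hv => absurd (by simp) hv, ?_⟩
    rw [Finset.sum_map_toList]
    exact ha
  have hsub1 : {a | ∑ v, ℓ v * (κ a v : ℝ) ≤ τ} ⊆ {a | h a ≤ τ} := fun a ha => (hle a).trans ha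
  have hsub2 : {a | h a ≤ τ} ⊆ {a | ∑ v, ℓ v * (κ a v : ℝ) ≤ σ} := fun a ha =>
    (hge a).trans (add_le_add ha le_rfl)
  have hfinh := (hT σ).subset hsub2
  refine ⟨hfinh, ?_⟩
  have hN1 : (({a | ∑ v, ℓ v * (κ a v : ℝ) ≤ τ}.ncard : ℕ) : ℝ) ≤ ({a | h a ≤ τ}.ncard : ℕ) := by
    exact_mod_cast Set.ncard_le_ncard hsub1 hfinh
  have hN2 : (({a | h a ≤ τ}.ncard : ℕ) : ℝ) ≤ ({a | ∑ v, ℓ v * (κ a v : ℝ) ≤ σ}.ncard : ℕ) := by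
    exact_mod_cast Set.ncard_le_ncard hsub2 (hT σ)
  set A := ∏ v ∈ Finset.univ.erase v₀, β v with hA
  have hA0 : 0 ≤ A := Finset.prod_nonneg fun v _ => hβ0 v
  have hAn : A ≤ n ^ p := by
    have := Finset.prod_le_prod (s := Finset.univ.erase v₀) (fun v _ => hβ0 v) fun v _ => hβn v
    rwa [Finset.prod_const, Finset.card_erase_of_mem (Finset.mem_univ _), Finset.card_univ, hcard,
      Nat.add_sub_cancel] at this
  have hfact1 : (1 : ℝ) ≤ p.factorial := by exact_mod_cast p.factorial_pos
  have hdiff : c * Real.exp (n * σ) * (A * (σ ^ p / p.factorial)) -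
      c * Real.exp (n * τ) * (A * (τ ^ p / p.factorial)) ≤
      c₁ * n ^ p * (Real.exp (n * J) * (J * (n * (D ^ p * (2 * J)) + p * D ^ (p - 1)))) *
        (Real.exp (n * τ) * u ^ (p - 1)) := by
    have d1 := exp_mul_pow_sub_le n p hτ0 hτσ
    have d2 : (σ - τ) * (n * (1 + σ) ^ p + p * (1 + σ) ^ (p - 1)) ≤
        J * (n * (D ^ p * (2 * J)) + p * D ^ (p - 1)) * u ^ (p - 1) := by
      have d3 : η * (1 + σ) ^ p ≤ D ^ p * (2 * J) * u ^ (p - 1) := by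
        calc η * (1 + σ) ^ p ≤ η * (D * u) ^ p := by gcongr
          _ = D ^ p * (η * u) * u ^ (p - 1) := by
            have : u ^ p = u * u ^ (p - 1) := by rw [← pow_succ', Nat.sub_add_cancel hp]
            rw [mul_pow, this]; ring
          _ ≤ _ := by gcongr
      have d4 : η * (1 + σ) ^ (p - 1) ≤ D ^ (p - 1) * u ^ (p - 1) := by
        rw [← mul_pow]
        exact (mul_le_of_le_one_left (by positivity) hη1).trans (by gcongr)
      calc _ = J * (n * (η * (1 + σ) ^ p) + p * (η * (1 + σ) ^ (p - 1))) := by rw [hσ]; ring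
        _ ≤ J * (n * (D ^ p * (2 * J) * u ^ (p - 1)) + p * (D ^ (p - 1) * u ^ (p - 1))) := by
          gcongr
        _ = _ := by ring
    have d5 : Real.exp (n * σ) ≤ Real.exp (n * J) * Real.exp (n * τ) := by
      rw [← Real.exp_add, Real.exp_le_exp, ← mul_add]
      gcongr
      linarith
    have d6 : c * A / p.factorial ≤ c₁ * n ^ p :=
      (div_le_self (by positivity) hfact1).trans (by gcongr)
    calc _ = c * A / p.factorial * (Real.exp (n * σ) * σ ^ p - Real.exp (n * τ) * τ ^ p) := by
          ring
      _ ≤ c₁ * n ^ p * ((Real.exp (n * J) * Real.exp (n * τ)) *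
          (J * (n * (D ^ p * (2 * J)) + p * D ^ (p - 1)) * u ^ (p - 1))) := by
          refine mul_le_mul d6 (d1.trans (mul_le_mul d5 d2 ?_ (by positivity))) ?_ (by positivity)
          · have := sub_nonneg.mpr hτσ
            positivity
          · rw [sub_nonneg]; gcongr
      _ = _ := by ring
  have hW : 0 ≤ c₁ * n ^ p * (Real.exp (n * J) *
      (J * (n * (D ^ p * (2 * J)) + p * D ^ (p - 1)))) * (Real.exp (n * τ) * u ^ (p - 1)) := by
    positivity
  rw [abs_le] at k1 k2 ⊢
  rw [add_mul]
  constructor <;> linarith [k1.1, k1.2, k2.1, k2.2]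

end CountAsymptotics

section LocalHeights

open NumberField.InfinitePlace NumberField.HeightOneSpectrum

variable {k : Type*} [Field k] [NumberField k] {n : ℕ}

theorem iSup_cons_one_le_iff {α : Type*} [One α] {f : α → ℝ} (hf : f 1 = 1) (a : Fin n → α)
    {c : ℝ} (hc : 1 ≤ c) :
    (⨆ i, f ((Fin.cons 1 a : Fin (n + 1) → α) i)) ≤ c ↔ ∀ i, f (a i) ≤ c := by
  rw [ciSup_le_iff (Set.finite_range _).bddAbove, Fin.forall_fin_succ]
  simp [hf, hc]

theorem one_le_iSup_cons_one {α : Type*} [One α] {f : α → ℝ} (hf : f 1 = 1) (a : Fin n → α) :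
    1 ≤ ⨆ i, f ((Fin.cons 1 a : Fin (n + 1) → α) i) :=
  Finite.le_ciSup_of_le 0 (by simp [hf])

/-- The factors `max {1, |a₁|_v, …, |aₙ|_v} ^ d_v` of the height at the infinite places and at the
primes in `F`. -/
noncomputable def localHeight (F : Finset (HeightOneSpectrum (𝓞 k))) (a : Fin n → k) :
    InfinitePlace k ⊕ F → ℝ :=
  Sum.elim (fun w => (⨆ i, w ((Fin.cons 1 a : Fin (n + 1) → k) i)) ^ mult w)
    fun 𝔭 => ⨆ i, FinitePlace.mk 𝔭.1 ((Fin.cons 1 a : Fin (n + 1) → k) i)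

variable (F : Finset (HeightOneSpectrum (𝓞 k)))

theorem one_le_localHeight (a : Fin n → k) (v : InfinitePlace k ⊕ F) : 1 ≤ localHeight F a v := by
  rcases v with w | 𝔭
  · exact one_le_pow₀ (one_le_iSup_cons_one (map_one w) a)
  · exact one_le_iSup_cons_one (map_one (FinitePlace.mk 𝔭.1)) a

theorem mulHeight_eq_prod_localHeight {a : Fin n → k}
    (ha : ∀ 𝔭 ∉ F, ∀ i, FinitePlace.mk 𝔭 (a i) ≤ 1) :
    Height.mulHeight (Fin.cons 1 a : Fin (n + 1) → k) = ∏ v, localHeight F a v := by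
  have h0 : (Fin.cons 1 a : Fin (n + 1) → k) ≠ 0 := fun h => by simpa using congrFun h 0
  rw [NumberField.mulHeight_eq h0, Fintype.prod_sum_type]
  congr 1
  rw [← finprod_comp_equiv FinitePlace.equivHeightOneSpectrum.symm,
    finprod_eq_prod_of_mulSupport_subset (s := F)]
  · exact (Finset.prod_coe_sort F
      fun 𝔭 => ⨆ i, FinitePlace.mk 𝔭 ((Fin.cons 1 a : Fin (n + 1) → k) i)).symm
  · intro 𝔭 h𝔭
    by_contra hF
    exact h𝔭 (le_antisymm ((iSup_cons_one_le_iff (map_one (FinitePlace.mk 𝔭)) a le_rfl).mpr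
      (ha 𝔭 hF)) (one_le_iSup_cons_one (map_one (FinitePlace.mk 𝔭)) a))

theorem exists_localHeight_inr_eq_pow (a : Fin n → k) (𝔭 : F) :
    ∃ j : ℕ, localHeight F a (Sum.inr 𝔭) = (Ideal.absNorm 𝔭.1.asIdeal : ℝ) ^ j := by
  have hN : (1 : ℝ) < Ideal.absNorm 𝔭.1.asIdeal := by exact_mod_cast one_lt_absNorm 𝔭.1
  have h1 := one_le_localHeight F a (Sum.inr 𝔭)
  obtain ⟨i, hi⟩ := exists_eq_ciSup_of_finite
    (f := fun i => FinitePlace.mk 𝔭.1 ((Fin.cons 1 a : Fin (n + 1) → k) i))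
  change _ = localHeight F a (Sum.inr 𝔭) at hi
  have hne : (Fin.cons 1 a : Fin (n + 1) → k) i ≠ 0 := by
    intro h
    rw [← hi, h, map_zero] at h1
    linarith
  obtain ⟨z, -, hz⟩ := finitePlace_mk_eq_zpow 𝔭.1 hne
  rw [← hi, hz] at h1 ⊢
  obtain ⟨j, rfl⟩ := Int.eq_ofNat_of_zero_le ((one_le_zpow_iff_right₀ hN).mp h1)
  exact ⟨j, zpow_natCast _ _⟩

theorem localHeight_inr_le_iff (a : Fin n → k) (𝔭 : F) {c : ℝ} (hc : 1 ≤ c) :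
    localHeight F a (Sum.inr 𝔭) ≤ c ↔ ∀ i, FinitePlace.mk 𝔭.1 (a i) ≤ c :=
  iSup_cons_one_le_iff (map_one (FinitePlace.mk 𝔭.1)) a hc

theorem localHeight_inl_le_iff (a : Fin n → k) (w : InfinitePlace k) {c : ℝ} (hc : 1 ≤ c) :
    localHeight F a (Sum.inl w) ≤ c ^ mult w ↔ ∀ i, w (a i) ≤ c := by
  rw [← iSup_cons_one_le_iff (map_one w) a hc]
  exact pow_le_pow_iff_left₀ (zero_le_one.trans (one_le_iSup_cons_one (map_one w) a))
    (zero_le_one.trans hc) mult_pos.ne'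

theorem weilHeight_le_iff {a : Fin n → k} (ha : ∀ 𝔭 ∉ F, ∀ i, FinitePlace.mk 𝔭 (a i) ≤ 1)
    {X : ℝ} (hX : 0 < X) :
    weilHeight a ≤ X ↔
      ∑ v, Real.log (localHeight F a v) ≤ Module.finrank ℚ k * Real.log X := by
  have hpos : ∀ v, 0 < localHeight F a v :=
    fun v => zero_lt_one.trans_le (one_le_localHeight F a v)
  have hm : (0 : ℝ) < Module.finrank ℚ k := by exact_mod_cast Module.finrank_pos
  rw [weilHeight, mulHeight_eq_prod_localHeight F ha,
    Real.rpow_inv_le_iff_of_pos (Finset.prod_nonneg fun v _ => (hpos v).le) hX.le hm,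
    ← Real.log_prod fun v _ => (hpos v).ne', ← Real.log_rpow hX]
  exact (Real.log_le_log_iff (Finset.prod_pos fun v _ => hpos v) (Real.rpow_pos_of_pos hX _)).symm

theorem mem_sIntegralPoints_iff (S : Finset (Place k)) {X : ℝ} (hX : 0 < X) (a : Fin n → k) :
    a ∈ sIntegralPoints S n X ↔ (∀ 𝔭 ∉ finPlaces S, ∀ i, FinitePlace.mk 𝔭 (a i) ≤ 1) ∧
      ∑ v, Real.log (localHeight (finPlaces S) a v) ≤ Module.finrank ℚ k * Real.log X := by
  have h : (∀ i, a i ∈ (finPlaces S : Set (HeightOneSpectrum (𝓞 k))).integer k) ↔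
      ∀ 𝔭 ∉ finPlaces S, ∀ i, FinitePlace.mk 𝔭 (a i) ≤ 1 := by
    simp only [finitePlace_mk_le_one_iff]
    exact ⟨fun h 𝔭 h𝔭 i => h i 𝔭 h𝔭, fun h i 𝔭 h𝔭 => h 𝔭 h𝔭 i⟩
  rw [← h]
  exact and_congr_right fun ha => weilHeight_le_iff _ (h.mp ha) hX

end LocalHeights

section BoxTuples

open NumberField.InfinitePlace NumberField.HeightOneSpectrum

variable {k : Type*} [Field k] [NumberField k]

variable (k) in
theorem idealConst_nonneg : 0 ≤ idealConst k := by
  unfold idealConst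
  positivity

variable (k) in
theorem idealConst_le : idealConst k ≤ (4 * Real.pi) ^ Module.finrank ℚ k := by
  have hd : (1 : ℝ) ≤ √|(discr k : ℝ)| := by
    rw [Real.one_le_sqrt]
    exact_mod_cast Int.one_le_abs (discr_ne_zero k)
  have hrs := card_add_two_mul_card_eq_rank k
  have hpi : (1 : ℝ) ≤ Real.pi := by linarith [Real.pi_gt_three]
  calc idealConst k ≤ 2 ^ nrRealPlaces k * Real.pi ^ nrComplexPlaces k * 2 ^ nrComplexPlaces k :=
        div_le_self (by positivity) hd
    _ ≤ (4 * Real.pi) ^ nrRealPlaces k * ((4 * Real.pi) ^ nrComplexPlaces k *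
          (4 * Real.pi) ^ nrComplexPlaces k) := by
        rw [mul_assoc]
        gcongr <;> linarith
    _ = _ := by rw [← pow_add, ← pow_add, ← hrs, two_mul]

theorem ncard_setOf_forall_mem {α : Type*} (n : ℕ) (s : Set α) :
    {a : Fin n → α | ∀ j, a j ∈ s}.ncard = s.ncard ^ n := by
  rw [← Nat.card_coe_set_eq, ← Nat.card_coe_set_eq]
  have h : {a : Fin n → α | ∀ j, a j ∈ s} ≃ (Fin n → s) :=
    Equiv.subtypePiEquivPi (β := fun _ : Fin n => α) (p := fun {_} x => x ∈ s)
  rw [Nat.card_congr h, Nat.card_fun, Nat.card_fin]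

theorem latticeConst_nonneg (d : ℕ) : 0 ≤ latticeConst d := by
  unfold latticeConst
  positivity

/-- The constant in the error term for the number of tuples in a box of a number field of
degree `m`. -/
noncomputable def tupleConst (m n : ℕ) : ℝ :=
  n * latticeConst m * ((4 * Real.pi) ^ m + latticeConst m) ^ (n - 1)

theorem tupleConst_nonneg (m n : ℕ) : 0 ≤ tupleConst m n := by
  have := latticeConst_nonneg m
  unfold tupleConst
  positivity

theorem abs_ncard_box_tuples_sub_le {n : ℕ} (hn : 0 < n) (F : Finset (HeightOneSpectrum (𝓞 k)))
    (e : F → ℕ) (t : InfinitePlace k → ℝ) (ht : ∀ w, 0 < t w) {y : ℝ} (hy : 1 ≤ y)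
    (hyt : y = (∏ w, t w ^ mult w) * ∏ 𝔭 : F, (Ideal.absNorm 𝔭.1.asIdeal : ℝ) ^ e 𝔭) :
    |({a : Fin n → k | ∀ j, a j ∈ boxElements F e t}.ncard : ℝ) - idealConst k ^ n * y ^ n| ≤
      tupleConst (Module.finrank ℚ k) n * y ^ (n - 1 / (Module.finrank ℚ k : ℝ)) := by
  set m := Module.finrank ℚ k with hm_def
  have hm : (1 : ℝ) ≤ m := by exact_mod_cast (Module.finrank_pos : 0 < Module.finrank ℚ k)
  have hb := abs_ncard_boxElements_sub_le F e t ht hy hyt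
  rw [← hm_def] at hb
  have hL := latticeConst_nonneg m
  have hI := idealConst_nonneg k
  have hI' := idealConst_le k
  have hy0 : 0 < y := by linarith
  have hyle : y ^ (1 - 1 / (m : ℝ)) ≤ y := by
    conv_rhs => rw [← Real.rpow_one y]
    exact Real.rpow_le_rpow_of_exponent_le hy (by simp)
  rw [ncard_setOf_forall_mem, Nat.cast_pow, ← mul_pow]
  set N : ℝ := ((boxElements F e t).ncard : ℝ)
  have hN : |N| ≤ ((4 * Real.pi) ^ m + latticeConst m) * y := by
    have h1 : |N| ≤ idealConst k * y + latticeConst m * y ^ (1 - 1 / (m : ℝ)) := by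
      rw [abs_of_nonneg (Nat.cast_nonneg _)]
      linarith [(abs_le.mp hb).2]
    refine h1.trans ?_
    rw [add_mul]
    gcongr
  have hM : |idealConst k * y| ≤ ((4 * Real.pi) ^ m + latticeConst m) * y := by
    rw [abs_of_nonneg (by positivity)]
    gcongr
    linarith
  calc _ ≤ |N - idealConst k * y| * n * max |N| |idealConst k * y| ^ (n - 1) :=
        abs_pow_sub_pow_le ..
    _ ≤ (latticeConst m * y ^ (1 - 1 / (m : ℝ))) * n *
          (((4 * Real.pi) ^ m + latticeConst m) * y) ^ (n - 1) := by
        gcongr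
        exact max_le hN hM
    _ = tupleConst m n * (y ^ (1 - 1 / (m : ℝ)) * y ^ (n - 1)) := by
        rw [tupleConst, mul_pow]
        ring
    _ = _ := by
        rw [← Real.rpow_add_natCast hy0.ne', Nat.cast_sub hn]
        congr 2
        push_cast
        ring

end BoxTuples

section HeightIndex

open NumberField.InfinitePlace NumberField.HeightOneSpectrum

variable {k : Type*} [Field k] [NumberField k] {n : ℕ} (F : Finset (HeightOneSpectrum (𝓞 k)))

/-- The step in which logarithmic local heights are measured: `η` at infinite places, and
`log N(𝔭)` at a prime `𝔭`. -/
noncomputable def heightStep (η : ℝ) : InfinitePlace k ⊕ F → ℝ :=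
  Sum.elim (fun _ => η) fun 𝔭 => Real.log (Ideal.absNorm 𝔭.1.asIdeal : ℝ)

/-- The logarithmic local heights, rounded up to multiples of the step. -/
noncomputable def heightIndex (η : ℝ) (a : Fin n → k) (v : InfinitePlace k ⊕ F) : ℕ :=
  ⌈Real.log (localHeight F a v) / heightStep F η v⌉₊

theorem log_two_le_log_absNorm (𝔭 : HeightOneSpectrum (𝓞 k)) :
    Real.log 2 ≤ Real.log (Ideal.absNorm 𝔭.asIdeal : ℝ) :=
  Real.log_le_log two_pos (by exact_mod_cast one_lt_absNorm 𝔭)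

theorem heightStep_pos {η : ℝ} (hη : 0 < η) (v : InfinitePlace k ⊕ F) : 0 < heightStep F η v := by
  rcases v with w | 𝔭
  · exact hη
  · exact (Real.log_pos one_lt_two).trans_le (log_two_le_log_absNorm 𝔭.1)

theorem heightIndex_le_iff {η : ℝ} (hη : 0 < η) (a : Fin n → k) (v : InfinitePlace k ⊕ F) (i : ℕ) :
    heightIndex F η a v ≤ i ↔ localHeight F a v ≤ Real.exp (heightStep F η v * i) := by
  rw [heightIndex, Nat.ceil_le, div_le_iff₀ (heightStep_pos F hη v), mul_comm,
    Real.log_le_iff_le_exp (zero_lt_one.trans_le (one_le_localHeight F a v))]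

theorem forall_heightIndex_le_iff {η : ℝ} (hη : 0 < η) (a : Fin n → k)
    (i : InfinitePlace k ⊕ F → ℕ) :
    ((∀ 𝔭 ∉ F, ∀ j, FinitePlace.mk 𝔭 (a j) ≤ 1) ∧ ∀ v, heightIndex F η a v ≤ i v) ↔
      ∀ j, a j ∈ boxElements F (fun 𝔭 => i (Sum.inr 𝔭))
        (fun w => Real.exp (η * i (Sum.inl w) / mult w)) := by
  have hinl : ∀ w : InfinitePlace k, heightIndex F η a (Sum.inl w) ≤ i (Sum.inl w) ↔
      ∀ j, w (a j) ≤ Real.exp (η * i (Sum.inl w) / mult w) := by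
    intro w
    rw [heightIndex_le_iff F hη, ← localHeight_inl_le_iff F a w
      (Real.one_le_exp (by positivity)), ← Real.exp_nat_mul,
      mul_div_cancel₀ _ (by exact_mod_cast mult_pos.ne')]
    rfl
  have hinr : ∀ 𝔭 : F, heightIndex F η a (Sum.inr 𝔭) ≤ i (Sum.inr 𝔭) ↔
      ∀ j, FinitePlace.mk 𝔭.1 (a j) ≤ (Ideal.absNorm 𝔭.1.asIdeal : ℝ) ^ i (Sum.inr 𝔭) := by
    intro 𝔭
    have hN : (1 : ℝ) < Ideal.absNorm 𝔭.1.asIdeal := by exact_mod_cast one_lt_absNorm 𝔭.1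
    rw [heightIndex_le_iff F hη, ← localHeight_inr_le_iff F a 𝔭 (one_le_pow₀ hN.le), heightStep,
      Sum.elim_inr, mul_comm, Real.exp_nat_mul, Real.exp_log (by linarith)]
  simp only [Sum.forall, hinl, hinr, boxElements, Set.mem_ofPred_eq]
  constructor
  · rintro ⟨h1, h2, h3⟩ j
    exact ⟨fun 𝔭 h => h1 𝔭 h j, fun 𝔭 => h3 𝔭 j, fun w => h2 w j⟩
  · intro h
    exact ⟨fun 𝔭 h𝔭 j => (h j).1 𝔭 h𝔭, fun w j => (h j).2.2 w, fun 𝔭 j => (h j).2.1 𝔭⟩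

theorem sum_log_localHeight_le {η : ℝ} (hη : 0 < η) (a : Fin n → k) :
    ∑ v, Real.log (localHeight F a v) ≤ ∑ v, heightStep F η v * heightIndex F η a v := by
  refine Finset.sum_le_sum fun v _ => ?_
  have h := heightStep_pos F hη v
  rw [← div_le_iff₀' h]
  exact Nat.le_ceil _

theorem sum_heightStep_mul_heightIndex_le {η : ℝ} (hη : 0 < η) (a : Fin n → k) :
    ∑ v, heightStep F η v * heightIndex F η a v ≤
      ∑ v, Real.log (localHeight F a v) + Fintype.card (InfinitePlace k ⊕ F) * η := by
  rw [← nsmul_eq_mul, Fintype.card, ← Finset.sum_const, ← Finset.sum_add_distrib]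
  refine Finset.sum_le_sum fun v _ => ?_
  have h := heightStep_pos F hη v
  have hlog := Real.log_nonneg (one_le_localHeight F a v)
  rcases v with w | 𝔭
  · have h1 := (Nat.ceil_lt_add_one (div_nonneg hlog h.le)).le
    have h2 := mul_le_mul_of_nonneg_left h1 h.le
    rw [mul_add, mul_div_cancel₀ _ h.ne', mul_one] at h2
    exact h2
  · obtain ⟨j, hj⟩ := exists_localHeight_inr_eq_pow F a 𝔭
    have h1 : heightIndex F η a (Sum.inr 𝔭) = j := by
      rw [heightIndex, hj, Real.log_pow]
      exact (congrArg Nat.ceil (mul_div_cancel_right₀ _ h.ne')).trans (Nat.ceil_natCast j)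
    rw [h1, hj, Real.log_pow, mul_comm]
    exact le_add_of_nonneg_right hη.le

end HeightIndex

section MainTheorem

open NumberField.InfinitePlace NumberField.HeightOneSpectrum

variable {k : Type*} [Field k] [NumberField k]

theorem card_infinitePlace_add_card_finPlaces {S : Finset (Place k)}
    (hS : ∀ v : InfinitePlace k, Sum.inl v ∈ S) :
    Fintype.card (InfinitePlace k) + (finPlaces S).card = S.card := by
  have h : S.toLeft = Finset.univ := by
    ext v
    simp [hS v]
  rw [finPlaces, ← Finset.card_toLeft_add_card_toRight (u := S), h, Finset.card_univ]

theorem card_placeNorms (S : Finset (Place k)) :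
    Multiset.card (placeNorms S) = (finPlaces S).card := by
  rw [placeNorms, Multiset.card_map, Finset.card_val]

variable (k) in
theorem card_infinitePlace_le_finrank :
    Fintype.card (InfinitePlace k) ≤ Module.finrank ℚ k := by
  rw [card_eq_nrRealPlaces_add_nrComplexPlaces, ← card_add_two_mul_card_eq_rank k]
  lia

/-- The leading coefficient at the place `v` in the count of points of bounded height: the density
of the values of the local height. -/
noncomputable def localDensity (n : ℕ) (F : Finset (HeightOneSpectrum (𝓞 k))) :
    InfinitePlace k ⊕ F → ℝ :=
  Sum.elim (fun _ => n) fun 𝔭 => 1 / Real.log (Ideal.absNorm 𝔭.1.asIdeal : ℝ) *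
    (1 - 1 / (Ideal.absNorm 𝔭.1.asIdeal : ℝ) ^ n)

theorem localDensity_inr (n : ℕ) (F : Finset (HeightOneSpectrum (𝓞 k))) (𝔭 : F) :
    localDensity n F (Sum.inr 𝔭) =
      (1 - Real.exp (-(n * Real.log (Ideal.absNorm 𝔭.1.asIdeal : ℝ)))) /
        Real.log (Ideal.absNorm 𝔭.1.asIdeal : ℝ) := by
  have hN : (1 : ℝ) < Ideal.absNorm 𝔭.1.asIdeal := by exact_mod_cast one_lt_absNorm 𝔭.1
  rw [localDensity, Sum.elim_inr, Real.exp_neg, Real.exp_nat_mul, Real.exp_log (by linarith)]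
  ring

open scoped Classical in
theorem prod_erase_localDensity (n : ℕ) (F : Finset (HeightOneSpectrum (𝓞 k)))
    (w₀ : InfinitePlace k) :
    ∏ v ∈ Finset.univ.erase (Sum.inl w₀), localDensity n F v =
      (n : ℝ) ^ (nrRealPlaces k + nrComplexPlaces k - 1) *
        ∏ 𝔭 ∈ F, (1 / Real.log (Ideal.absNorm 𝔭.asIdeal : ℝ) *
          (1 - 1 / (Ideal.absNorm 𝔭.asIdeal : ℝ) ^ n)) := by
  have h : (Finset.univ : Finset (InfinitePlace k ⊕ F)).erase (Sum.inl w₀) =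
      (Finset.univ.erase w₀).disjSum Finset.univ := by
    ext v
    rcases v with w | 𝔭 <;> simp
  rw [h, Finset.prod_disjSum]
  congr 1
  · simp only [localDensity, Sum.elim_inl, Finset.prod_const]
    rw [Finset.card_erase_of_mem (Finset.mem_univ _), Finset.card_univ,
      card_eq_nrRealPlaces_add_nrComplexPlaces]
  · exact Finset.prod_coe_sort F fun 𝔭 => 1 / Real.log (Ideal.absNorm 𝔭.asIdeal : ℝ) *
      (1 - 1 / (Ideal.absNorm 𝔭.asIdeal : ℝ) ^ n)

theorem idealConst_pow_mul_eq (S : Finset (Place k)) (n : ℕ) (E u : ℝ) :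
    idealConst k ^ n * E * ((n : ℝ) ^ (nrRealPlaces k + nrComplexPlaces k - 1) *
        (∏ 𝔭 ∈ finPlaces S, (1 / Real.log (Ideal.absNorm 𝔭.asIdeal : ℝ) *
          (1 - 1 / (Ideal.absNorm 𝔭.asIdeal : ℝ) ^ n))) *
        ((Module.finrank ℚ k * u) ^ (S.card - 1) / (S.card - 1).factorial)) =
      (2 ^ nrRealPlaces k * Real.pi ^ nrComplexPlaces k) ^ n * constB k S n * E *
        u ^ (S.card - 1) := by
  rw [idealConst, constB, pow_mul, div_pow, mul_pow _ (2 ^ nrComplexPlaces k), mul_pow _ u]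
  have hf : ((S.card - 1).factorial : ℝ) ≠ 0 := by exact_mod_cast Nat.factorial_ne_zero _
  have hd : √|(discr k : ℝ)| ^ n ≠ 0 := by
    have : (0 : ℝ) < |(discr k : ℝ)| := abs_pos.mpr (by exact_mod_cast discr_ne_zero k)
    positivity
  generalize ∏ 𝔭 ∈ finPlaces S, (1 / Real.log (Ideal.absNorm 𝔭.asIdeal : ℝ) *
          (1 - 1 / (Ideal.absNorm 𝔭.asIdeal : ℝ) ^ n)) = P
  field_simp

theorem exp_natCast_mul_mul_log {X : ℝ} (hX : 0 < X) (m n : ℕ) :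
    Real.exp (n * (m * Real.log X)) = X ^ (m * n) := by
  rw [Real.exp_nat_mul, Real.exp_nat_mul, Real.exp_log hX, pow_mul]

theorem exists_abs_ncard_sIntegralPoints_sub_le (m n p : ℕ) (hn : 0 < n) (hm : 0 < m)
    (hp : 0 < p) :
    ∃ C : ℝ, ∀ (k : Type*) [Field k] [NumberField k] (S : Finset (Place k)),
      Module.finrank ℚ k = m → (∀ v : InfinitePlace k, Sum.inl v ∈ S) → S.card = p + 1 →
      ∀ X : ℝ, 2 ≤ X → (sIntegralPoints S n X).Finite ∧
        |((sIntegralPoints S n X).ncard : ℝ) -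
            (2 ^ nrRealPlaces k * Real.pi ^ nrComplexPlaces k) ^ n *
              constB k S n * X ^ (m * n) * Real.log X ^ p| ≤
          C * (X ^ (m * n) * Real.log X ^ (p - 1)) := by
  classical
  obtain ⟨C, hC⟩ := exists_abs_ncard_le_height_sub_le n m p hn hm hp
    (c₁ := ((4 * Real.pi) ^ m) ^ n) (tupleConst_nonneg m n)
  refine ⟨C, fun k _ _ S hkm hS hcard X hX => ?_⟩
  have hX0 : 0 < X := by linarith
  set F := finPlaces S with hF
  set u := Real.log X with hu
  set η := Real.exp (-(u / (2 * (p + 1)))) with hη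
  have hη0 : 0 < η := Real.exp_pos _
  have hι : Fintype.card (InfinitePlace k ⊕ F) = p + 1 := by
    rw [Fintype.card_sum, Fintype.card_coe, card_infinitePlace_add_card_finPlaces hS, hcard]
  obtain ⟨w₀⟩ : Nonempty (InfinitePlace k) := inferInstance
  let Ω := {a : Fin n → k // ∀ 𝔭 ∉ F, ∀ j, FinitePlace.mk 𝔭 (a j) ≤ 1}
  have himage : ∀ i : InfinitePlace k ⊕ F → ℕ,
      Subtype.val '' {a : Ω | ∀ v, heightIndex F η a.1 v ≤ i v} =
        {a : Fin n → k | ∀ j, a j ∈ boxElements F (fun 𝔭 => i (Sum.inr 𝔭))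
          (fun w => Real.exp (η * i (Sum.inl w) / mult w))} := by
    intro i
    ext a
    rw [Set.mem_ofPred_eq, ← forall_heightIndex_le_iff F hη0]
    constructor
    · rintro ⟨a, ha, rfl⟩
      exact ⟨a.2, ha⟩
    · rintro ⟨h1, h2⟩
      exact ⟨⟨a, h1⟩, h2, rfl⟩
  have hpoints : Subtype.val '' {a : Ω | ∑ v, Real.log (localHeight F a.1 v) ≤ m * u} =
      sIntegralPoints S n X := by
    ext a
    rw [mem_sIntegralPoints_iff S hX0, hkm]
    constructor
    · rintro ⟨a, ha, rfl⟩
      exact ⟨a.2, ha⟩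
    · rintro ⟨h1, h2⟩
      exact ⟨⟨a, h1⟩, h2, rfl⟩
  have key := hC (Ω := Ω) hι (Sum.inl w₀) (u := u) (η := η) (c := idealConst k ^ n)
    (Real.log_le_log two_pos hX) rfl (pow_nonneg (idealConst_nonneg k) n)
    (pow_le_pow_left₀ (idealConst_nonneg k) (hkm ▸ idealConst_le k) n)
    (κ := fun a => heightIndex F η a.1) (ℓ := heightStep F η) (β := localDensity n F)
    (h := fun a => ∑ v, Real.log (localHeight F a.1 v)) rfl ?_ ?_ ?_
    (fun a => sum_log_localHeight_le F hη0 a.1) ?_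
  · rw [← hpoints, Set.ncard_image_of_injective _ Subtype.val_injective]
    refine ⟨key.1.image _, ?_⟩
    have h := key.2
    have hmain := idealConst_pow_mul_eq S n (X ^ (m * n)) u
    rw [hcard, Nat.add_sub_cancel, hkm] at hmain
    rwa [exp_natCast_mul_mul_log hX0, prod_erase_localDensity, hmain] at h
  · rintro (w | 𝔭)
    · exact Or.inl ⟨rfl, rfl⟩
    · exact Or.inr ⟨log_two_le_log_absNorm 𝔭.1, localDensity_inr n F 𝔭⟩
  · intro i
    refine Set.Finite.of_finite_image ?_ Subtype.val_injective.injOn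
    rw [himage]
    exact Set.Finite.subset (Set.Finite.pi' fun _ => finite_boxElements F _ _ fun _ =>
      Real.exp_pos _) fun a ha => ha
  · intro i
    rw [← Set.ncard_image_of_injective _ Subtype.val_injective, himage]
    have hy : Real.exp (∑ v, heightStep F η v * i v) =
        (∏ w, Real.exp (η * i (Sum.inl w) / mult w) ^ mult w) *
          ∏ 𝔭 : F, (Ideal.absNorm 𝔭.1.asIdeal : ℝ) ^ i (Sum.inr 𝔭) := by
      rw [Real.exp_sum, Fintype.prod_sum_type]
      congr 1
      · refine Finset.prod_congr rfl fun w _ => ?_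
        rw [← Real.exp_nat_mul, mul_div_cancel₀ _ (by exact_mod_cast mult_pos.ne')]
        rfl
      · refine Finset.prod_congr rfl fun 𝔭 _ => ?_
        have hN : (1 : ℝ) < Ideal.absNorm 𝔭.1.asIdeal := by exact_mod_cast one_lt_absNorm 𝔭.1
        rw [heightStep, Sum.elim_inr, mul_comm, Real.exp_nat_mul, Real.exp_log (by linarith)]
    have h := abs_ncard_box_tuples_sub_le hn F _ _ (fun w => Real.exp_pos _)
      (Real.one_le_exp (Finset.sum_nonneg fun v _ =>
        mul_nonneg (heightStep_pos F hη0 v).le (Nat.cast_nonneg _))) hy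
    rw [hkm, ← Real.exp_nat_mul, ← Real.exp_mul] at h
    rwa [mul_comm ((n : ℝ) - 1 / m)]
  · intro a
    have h := sum_heightStep_mul_heightIndex_le F hη0 a.1
    rw [hι] at h
    exact_mod_cast h

theorem abs_ncard_sIntegralPoints_sub_le_of_card_eq_one {m n : ℕ} (hn : 0 < n)
    (S : Finset (Place k)) (hkm : Module.finrank ℚ k = m)
    (hS : ∀ v : InfinitePlace k, Sum.inl v ∈ S) (hcard : S.card = 1) {X : ℝ} (hX : 2 ≤ X) :
    (sIntegralPoints S n X).Finite ∧
      |((sIntegralPoints S n X).ncard : ℝ) -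
          (2 ^ nrRealPlaces k * Real.pi ^ nrComplexPlaces k) ^ n * constB k S n * X ^ (m * n)| ≤
        tupleConst m n * X ^ (m * n - 1) := by
  have hX0 : 0 < X := by linarith
  have hm : 0 < m := hkm ▸ Module.finrank_pos
  have hsum := card_infinitePlace_add_card_finPlaces hS
  have hpos : 0 < Fintype.card (InfinitePlace k) := Fintype.card_pos
  obtain ⟨w₀, hw₀⟩ := Fintype.card_eq_one_iff.mp (show Fintype.card (InfinitePlace k) = 1 by lia)
  have hF : finPlaces S = ∅ := Finset.card_eq_zero.mp (by lia)
  have huniv : (Finset.univ : Finset (InfinitePlace k)) = {w₀} := by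
    ext w
    simp [hw₀ w]
  have hmult : mult w₀ = m := by
    rw [← hkm, ← sum_mult_eq, huniv, Finset.sum_singleton]
  have hmem : ∀ a : Fin n → k, a ∈ sIntegralPoints S n X ↔
      ∀ j, a j ∈ boxElements (finPlaces S) (fun _ => 0) (fun _ => X) := by
    intro a
    have hempty : IsEmpty (finPlaces S) := by
      rw [hF]
      infer_instance
    rw [mem_sIntegralPoints_iff S hX0, Fintype.sum_sum_type, Finset.univ_eq_empty (α := finPlaces S),
      Finset.sum_empty, add_zero, huniv, Finset.sum_singleton, hkm, ← Real.log_pow,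
      Real.log_le_log_iff (zero_lt_one.trans_le (one_le_localHeight _ a _)) (pow_pos hX0 m),
      ← hmult, localHeight_inl_le_iff _ a w₀ (by linarith)]
    constructor
    · rintro ⟨h1, h2⟩ j
      exact ⟨fun 𝔭 h => h1 𝔭 h j, fun 𝔭 => isEmptyElim 𝔭, fun w => hw₀ w ▸ h2 j⟩
    · exact fun h => ⟨fun 𝔭 h𝔭 j => (h j).1 𝔭 h𝔭, fun j => (h j).2.2 w₀⟩
  have hset : sIntegralPoints S n X =
      {a : Fin n → k | ∀ j, a j ∈ boxElements (finPlaces S) (fun _ => 0) (fun _ => X)} :=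
    Set.ext hmem
  have h := abs_ncard_box_tuples_sub_le hn (finPlaces S) (fun _ => 0) (fun _ => X)
    (fun _ => hX0) (y := X ^ m) (one_le_pow₀ (by linarith)) (by simp [huniv, hmult])
  rw [hset]
  refine ⟨Set.Finite.subset (Set.Finite.pi' fun _ => finite_boxElements (finPlaces S) _ _ fun _ =>
    hX0) fun a ha => ha, ?_⟩
  have hmain := idealConst_pow_mul_eq S n (X ^ (m * n)) 1
  have hrs : nrRealPlaces k + nrComplexPlaces k - 1 = 0 := by
    rw [← card_eq_nrRealPlaces_add_nrComplexPlaces]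
    lia
  rw [hcard, hF, hrs] at hmain
  simp only [Nat.sub_self, pow_zero, Finset.prod_empty, Nat.factorial_zero, Nat.cast_one, div_one,
    mul_one] at hmain
  have hpow : (X ^ m) ^ (n - 1 / (m : ℝ)) = X ^ (m * n - 1) := by
    rw [← Real.rpow_natCast X m, ← Real.rpow_mul hX0.le, ← Real.rpow_natCast X (m * n - 1),
      Nat.cast_sub (Nat.mul_pos hm hn)]
    congr 1
    have : (m : ℝ) ≠ 0 := by exact_mod_cast hm.ne'
    push_cast
    field_simp
  rw [hkm, hpow, ← pow_mul, hmain] at h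
  exact h

end MainTheorem

theorem theorem1 (m n : ℕ) (hn : 0 < n) (q : Multiset ℕ) :
    ∃ C : ℝ, ∀ (k : Type*) [Field k] [NumberField k] (S : Finset (Place k)),
      Module.finrank ℚ k = m →
      (∀ v : InfinitePlace k, Sum.inl v ∈ S) →
      placeNorms S = q →
      ∀ X : ℝ, 2 ≤ X →
        (sIntegralPoints S n X).Finite ∧
        |((sIntegralPoints S n X).ncard : ℝ) -
            (2 ^ InfinitePlace.nrRealPlaces k * Real.pi ^ InfinitePlace.nrComplexPlaces k) ^ n *
              constB k S n * X ^ (m * n) * Real.log X ^ (S.card - 1)| ≤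
          if 1 < S.card then C * (X ^ (m * n) * Real.log X ^ (S.card - 2))
          else C * X ^ (m * n - 1) := by
  rcases Nat.eq_zero_or_pos m with rfl | hm
  · exact ⟨0, fun k _ _ S hkm => absurd hkm Module.finrank_pos.ne'⟩
  choose C hC using fun p : ℕ =>
    exists_abs_ncard_sIntegralPoints_sub_le m n (p + 1) hn hm p.succ_pos
  have hT := tupleConst_nonneg m n
  have hsum : 0 ≤ ∑ p ∈ Finset.range (m + Multiset.card q), |C p| :=
    Finset.sum_nonneg fun _ _ => abs_nonneg _
  refine ⟨tupleConst m n + ∑ p ∈ Finset.range (m + Multiset.card q), |C p|,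
    fun k _ _ S hkm hS hq X hX => ?_⟩
  have hlog : 0 ≤ Real.log X := Real.log_nonneg (by linarith)
  have hX0 : 0 < X := by linarith
  have hcard := card_infinitePlace_add_card_finPlaces hS
  have hpos : 0 < Fintype.card (InfinitePlace k) := Fintype.card_pos
  have hle := card_infinitePlace_le_finrank k
  rw [← card_placeNorms, hq] at hcard
  split_ifs with h1
  · obtain ⟨p, hp⟩ : ∃ p, S.card = p + 1 + 1 := ⟨S.card - 2, by lia⟩
    obtain ⟨hfin, h⟩ := hC p k S hkm hS hp X hX
    refine ⟨hfin, ?_⟩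
    rw [hp]
    simp only [Nat.add_sub_cancel] at h ⊢
    refine h.trans (mul_le_mul_of_nonneg_right ?_ (by positivity))
    have := Finset.single_le_sum (f := fun p => |C p|) (fun _ _ => abs_nonneg _)
      (Finset.mem_range.mpr (show p < m + Multiset.card q by lia))
    linarith [le_abs_self (C p)]
  · have hS1 : S.card = 1 := by lia
    obtain ⟨hfin, h⟩ := abs_ncard_sIntegralPoints_sub_le_of_card_eq_one hn S hkm hS hS1 hX
    refine ⟨hfin, ?_⟩
    rw [hS1, Nat.sub_self, pow_zero, mul_one]
    refine h.trans (mul_le_mul_of_nonneg_right ?_ (by positivity))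
    linarith
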